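/- Let $k$ be a commutative ring; algebras are associative and unital, $\otimes=\otimes_k$. A \emph{(noncommutative) torsor} is a $k$-algebra $T$ with an algebra map $\mu\colon T\to T\otimes T^{op}\otimes T$, written $\mu(x)=x^{(1)}\otimes x^{(2)}\otimes x^{(3)}$, such that $$\mu(x^{(1)})\otimes x^{(2)}\otimes x^{(3)}=x^{(1)}\otimes x^{(2)}\otimes\mu(x^{(3)}),\quad x^{(1)}x^{(2)}\otimes x^{(3)}=1\otimes x,\quad x^{(1)}\otimes x^{(2)}x^{(3)}=x\otimes 1 .$$ It is \emph{faithfully flat} if $T$ is a faithfully flat $k$-module. A morphism of torsors $(T,\mu)\to(T',\mu')$ is an algebra map $f\colon T\to T'$ with $(f\otimes f\otimes f)\mu=\mu' f$. A \emph{Grunspan map} for $(T,\mu)$ is an algebra endomorphism $\theta$ of $T$ with $$(T\otimes T^{op}\otimes\theta\otimes T^{op}\otimes T)(\mu\otimes T^{op}\otimes T)\mu=(T\otimes\mu^{op}\otimes T)\mu,\qquad (\theta\otimes\theta\otimes\theta)\mu=\mu\theta,$$ where $\mu^{op}(x)=x^{(3)}\otimes x^{(2)}\otimes x^{(1)}$.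 A \emph{faithfully flat Hopf--Galois object} $(T,H,\delta)$ consists of a $k$-flat Hopf algebra $H$ and a right $H$-comodule algebra $T$ with coaction $\delta\colon T\to T\otimes H$, $\delta(x)=x_{(0)}\otimes x_{(1)}$, such that $T$ is a faithfully flat $k$-module, the Galois map $\beta\colon T\otimes T\to T\otimes H$, $x\otimes y\mapsto xy_{(0)}\otimes y_{(1)}$, is bijective, and $\{x\in T\mid\delta(x)=x\otimes 1\}=k$ (the image of $k$ in $T$). A morphism $(T,H,\delta)\to(T',H',\delta')$ is a pair $(f,g)$ of an algebra map $f\colon T\to T'$ and a bialgebra map $g\colon H\to H'$ with $\delta' f=(f\otimes g)\delta$. \textbf{Corollary.} \begin{enumerate} \item Every faithfully flat torsor $(T,\mu)$ has a Grunspan map, and it has exactly one. (So the map $\theta$ in Grunspan's axioms for quantum torsors is redundant.) \item Faithfully flat torsors are equivalent to faithfully flat Hopf--Galois objects. Precisely: \begin{enumerate} \item if $(T,H,\delta)$ is a faithfully flat Hopf--Galois object, then $\mu_\delta(x)=x_{(0)}\otimes\beta^{-1}(1\otimes x_{(1)})$ is an algebra map $T\to T\otimes T^{op}\otimes T$ making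 $T$ a torsor; \item for every faithfully flat torsor $(T,\mu)$ there are a Hopf algebra $H$ and a coaction $\delta$ of $H$ on $T$ such that $(T,H,\delta)$ is a faithfully flat Hopf--Galois object with $\mu_\delta=\mu$; \item for faithfully flat Hopf--Galois objects $(T,H,\delta)$, $(T',H',\delta')$ and an algebra map $f\colon T\to T'$: if $f$ is a morphism of torsors $(T,\mu_\delta)\to(T',\mu_{\delta'})$, then there is exactly one bialgebra map $g\colon H\to H'$ such that $(f,g)$ is a morphism of Hopf--Galois objects; conversely, if $(f,g)$ is a morphism of Hopf--Galois objects for some $g$, then $f$ is a morphism of torsors. \end{enumerate} \end{enumerate} -/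

import Mathlib

open scoped TensorProduct

universe u v v' w w'

namespace QuantumTorsor

noncomputable section

section Torsor

variable (k : Type*) [CommRing k] (T : Type*) [Ring T] [Algebra k T]

/-- The multiplication `T ⊗ Tᵒᵖ → T`, `x ⊗ op y ↦ x * y`. -/
def mulRight : T ⊗[k] Tᵐᵒᵖ →ₗ[k] T :=
  LinearMap.mul' k T ∘ₗ
    TensorProduct.map LinearMap.id (MulOpposite.opLinearEquiv k (M := T)).symm.toLinearMap

/-- The multiplication `Tᵒᵖ ⊗ T → T`, `op x ⊗ y ↦ x * y`. -/
def mulLeft : Tᵐᵒᵖ ⊗[k] T →ₗ[k] T :=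
  LinearMap.mul' k T ∘ₗ
    TensorProduct.map (MulOpposite.opLinearEquiv k (M := T)).symm.toLinearMap LinearMap.id

/-- Rebracketing `(a ⊗ b ⊗ c) ⊗ (d ⊗ e) ↦ a ⊗ b ⊗ c ⊗ d ⊗ e`. -/
def flattenLeft :
    (T ⊗[k] (Tᵐᵒᵖ ⊗[k] T)) ⊗[k] (Tᵐᵒᵖ ⊗[k] T) →ₗ[k]
      T ⊗[k] (Tᵐᵒᵖ ⊗[k] (T ⊗[k] (Tᵐᵒᵖ ⊗[k] T))) :=
  (TensorProduct.assoc k Tᵐᵒᵖ T (Tᵐᵒᵖ ⊗[k] T)).toLinearMap.lTensor T ∘ₗ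
    (TensorProduct.assoc k T (Tᵐᵒᵖ ⊗[k] T) (Tᵐᵒᵖ ⊗[k] T)).toLinearMap

/-- Rebracketing `a ⊗ ((b ⊗ c ⊗ d) ⊗ e) ↦ a ⊗ b ⊗ c ⊗ d ⊗ e`. -/
def flattenMiddle :
    T ⊗[k] ((Tᵐᵒᵖ ⊗[k] (T ⊗[k] Tᵐᵒᵖ)) ⊗[k] T) →ₗ[k]
      T ⊗[k] (Tᵐᵒᵖ ⊗[k] (T ⊗[k] (Tᵐᵒᵖ ⊗[k] T))) :=
  ((TensorProduct.assoc k T Tᵐᵒᵖ T).toLinearMap.lTensor Tᵐᵒᵖ ∘ₗ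
    (TensorProduct.assoc k Tᵐᵒᵖ (T ⊗[k] Tᵐᵒᵖ) T).toLinearMap).lTensor T

/-- The map `x ⊗ op y ⊗ z ↦ op z ⊗ y ⊗ op x`. -/
def reverse : T ⊗[k] (Tᵐᵒᵖ ⊗[k] T) →ₗ[k] Tᵐᵒᵖ ⊗[k] (T ⊗[k] Tᵐᵒᵖ) :=
  (TensorProduct.assoc k Tᵐᵒᵖ T Tᵐᵒᵖ).toLinearMap ∘ₗ
    (TensorProduct.comm k T Tᵐᵒᵖ).toLinearMap.rTensor Tᵐᵒᵖ ∘ₗ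
      (TensorProduct.comm k Tᵐᵒᵖ (T ⊗[k] Tᵐᵒᵖ)).toLinearMap ∘ₗ
        TensorProduct.map (MulOpposite.opLinearEquiv k (M := T)).toLinearMap
          (TensorProduct.map (MulOpposite.opLinearEquiv k (M := T)).symm.toLinearMap
            (MulOpposite.opLinearEquiv k (M := T)).toLinearMap)

variable {k T}

/-- `μ : T → T ⊗ Tᵒᵖ ⊗ T`, written `μ(x) = x⁽¹⁾ ⊗ x⁽²⁾ ⊗ x⁽³⁾`, is a (noncommutative) torsor
structure on the algebra `T`. -/
structure IsTorsor (μ : T →ₐ[k] T ⊗[k] (Tᵐᵒᵖ ⊗[k] T)) : Prop where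
  /-- `μ(x⁽¹⁾) ⊗ x⁽²⁾ ⊗ x⁽³⁾ = x⁽¹⁾ ⊗ x⁽²⁾ ⊗ μ(x⁽³⁾)` -/
  coassoc :
    flattenLeft k T ∘ₗ μ.toLinearMap.rTensor (Tᵐᵒᵖ ⊗[k] T) ∘ₗ μ.toLinearMap =
      (μ.toLinearMap.lTensor Tᵐᵒᵖ).lTensor T ∘ₗ μ.toLinearMap
  /-- `x⁽¹⁾ ⊗ x⁽²⁾x⁽³⁾ = x ⊗ 1` -/
  mul_left : ∀ x : T, (mulLeft k T).lTensor T (μ x) = x ⊗ₜ[k] (1 : T)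
  /-- `x⁽¹⁾x⁽²⁾ ⊗ x⁽³⁾ = 1 ⊗ x` -/
  mul_right : ∀ x : T,
    (mulRight k T).rTensor T ((TensorProduct.assoc k T Tᵐᵒᵖ T).symm (μ x)) = (1 : T) ⊗ₜ[k] x

/-- For an algebra map `f : T → T'`, the algebra map
`f ⊗ f ⊗ f : T ⊗ Tᵒᵖ ⊗ T → T' ⊗ T'ᵒᵖ ⊗ T'`. -/
def tripleMap {T' : Type*} [Ring T'] [Algebra k T'] (f : T →ₐ[k] T') :
    T ⊗[k] (Tᵐᵒᵖ ⊗[k] T) →ₐ[k] T' ⊗[k] (T'ᵐᵒᵖ ⊗[k] T') :=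
  Algebra.TensorProduct.map f (Algebra.TensorProduct.map (AlgHom.op f) f)

/-- `f : T → T'` is a morphism of torsors `(T, μ) → (T', μ')`. -/
def IsTorsorHom {T' : Type*} [Ring T'] [Algebra k T']
    (μ : T →ₐ[k] T ⊗[k] (Tᵐᵒᵖ ⊗[k] T)) (μ' : T' →ₐ[k] T' ⊗[k] (T'ᵐᵒᵖ ⊗[k] T'))
    (f : T →ₐ[k] T') : Prop :=
  (tripleMap f).comp μ = μ'.comp f

/-- The map `μᵒᵖ : Tᵒᵖ → Tᵒᵖ ⊗ T ⊗ Tᵒᵖ`, `x ↦ x⁽³⁾ ⊗ x⁽²⁾ ⊗ x⁽¹⁾`. -/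
def muOp (μ : T →ₐ[k] T ⊗[k] (Tᵐᵒᵖ ⊗[k] T)) : Tᵐᵒᵖ →ₗ[k] Tᵐᵒᵖ ⊗[k] (T ⊗[k] Tᵐᵒᵖ) :=
  reverse k T ∘ₗ μ.toLinearMap ∘ₗ (MulOpposite.opLinearEquiv k (M := T)).symm.toLinearMap

/-- The algebra endomorphism `θ` is a Grunspan map for `(T, μ)`. -/
structure IsGrunspanMap (μ : T →ₐ[k] T ⊗[k] (Tᵐᵒᵖ ⊗[k] T)) (θ : T →ₐ[k] T) : Prop where
  /-- `(T ⊗ Tᵒᵖ ⊗ θ ⊗ Tᵒᵖ ⊗ T)(μ ⊗ Tᵒᵖ ⊗ T)μ = (T ⊗ μᵒᵖ ⊗ T)μ` -/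
  compat :
    ((θ.toLinearMap.rTensor (Tᵐᵒᵖ ⊗[k] T)).lTensor Tᵐᵒᵖ).lTensor T ∘ₗ
        flattenLeft k T ∘ₗ μ.toLinearMap.rTensor (Tᵐᵒᵖ ⊗[k] T) ∘ₗ μ.toLinearMap =
      flattenMiddle k T ∘ₗ ((muOp μ).rTensor T).lTensor T ∘ₗ μ.toLinearMap
  /-- `(θ ⊗ θ ⊗ θ)μ = μθ` -/
  isTorsorHom : IsTorsorHom μ μ θ

end Torsor

section HopfGalois

variable {k : Type*} [CommRing k] {T : Type*} [Ring T] [Algebra k T]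
  {H : Type*} [Ring H] [HopfAlgebra k H]

/-- The Galois map `β : T ⊗ T → T ⊗ H`, `x ⊗ y ↦ (x ⊗ 1) * δ(y)`. -/
def galoisMap (δ : T →ₐ[k] T ⊗[k] H) : T ⊗[k] T →ₗ[k] T ⊗[k] H :=
  LinearMap.mul' k (T ⊗[k] H) ∘ₗ
    TensorProduct.map
      (Algebra.TensorProduct.includeLeft : T →ₐ[k] T ⊗[k] H).toLinearMap δ.toLinearMap

/-- The algebra map `δ : T → T ⊗ H` makes `T` into a right `H`-comodule algebra. -/
structure IsComoduleAlgebra (δ : T →ₐ[k] T ⊗[k] H) : Prop where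
  coassoc :
    (TensorProduct.assoc k T H H).toLinearMap ∘ₗ δ.toLinearMap.rTensor H ∘ₗ δ.toLinearMap =
      (Coalgebra.comul (R := k) (A := H)).lTensor T ∘ₗ δ.toLinearMap
  counit : ∀ x : T, (Coalgebra.counit (R := k) (A := H)).lTensor T (δ x) = x ⊗ₜ[k] (1 : k)

/-- The coaction `δ : T → T ⊗ H` makes `T` into a faithfully flat right `H`-Galois object
over `k`, where `H` is a `k`-flat Hopf algebra. -/
structure IsHopfGaloisObject (δ : T →ₐ[k] T ⊗[k] H) : Prop extends IsComoduleAlgebra δ where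
  flat : Module.Flat k H
  faithfullyFlat : Module.FaithfullyFlat k T
  bijective : Function.Bijective (galoisMap δ)
  coinvariants : ∀ x : T, δ x = x ⊗ₜ[k] (1 : H) ↔ x ∈ Set.range (algebraMap k T)

/-- The map `H → T ⊗ T`, `h ↦ β⁻¹(1 ⊗ h)`. -/
def translationMap (δ : T →ₐ[k] T ⊗[k] H) (hβ : Function.Bijective (galoisMap δ)) :
    H →ₗ[k] T ⊗[k] T :=
  (LinearEquiv.ofBijective (galoisMap δ) hβ).symm.toLinearMap ∘ₗ TensorProduct.mk k T H 1

/-- The map `T → T ⊗ Tᵒᵖ ⊗ T` determined by a coaction with bijective Galois map: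
`x ↦ x₍₀₎ ⊗ β⁻¹(1 ⊗ x₍₁₎)`. -/
def inducedMu (δ : T →ₐ[k] T ⊗[k] H) (hβ : Function.Bijective (galoisMap δ)) :
    T →ₗ[k] T ⊗[k] (Tᵐᵒᵖ ⊗[k] T) :=
  ((MulOpposite.opLinearEquiv k (M := T)).toLinearMap.rTensor T ∘ₗ
    translationMap δ hβ).lTensor T ∘ₗ δ.toLinearMap

/-- `(f, g)` is a morphism from `T` with its `H`-coaction `δ` to `T'` with its `H'`-coaction
`δ'`, for an algebra map `f : T → T'` and a bialgebra map `g : H → H'`. -/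
def IsCoactionHom {T' : Type*} [Ring T'] [Algebra k T'] {H' : Type*} [Ring H']
    [HopfAlgebra k H'] (δ : T →ₐ[k] T ⊗[k] H) (δ' : T' →ₐ[k] T' ⊗[k] H')
    (f : T →ₐ[k] T') (g : H →ₐc[k] H') : Prop :=
  (Algebra.TensorProduct.map f (g : H →ₐ[k] H')).comp δ = δ'.comp f

end HopfGalois

end

end QuantumTorsor

/-! Everything is read off the Galois map β(x ⊗ y) = x δ(y). When β is bijective, β⁻¹ is the left
T-linear extension of τ(h) = β⁻¹(1 ⊗ h) =: h⁽¹⁾ ⊗ h⁽²⁾, and τ : H → Tᵒᵖ ⊗ T is an algebra map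
(`exists_algHom_translation`). A Galois object is therefore handled as a pair (δ, τ),
`IsTranslation`, with torsor μ(x) = x₍₀₎ ⊗ τ(x₍₁₎). The torsor axioms come from h⁽¹⁾ ⊗ δ(h⁽²⁾) =
τ(h₍₁₎) ⊗ h₍₂₎, from h⁽¹⁾h⁽²⁾ = ε(h), and from x₍₀₎τ(x₍₁₎) = 1 ⊗ x.

Conversely, a faithfully flat torsor determines H inside Tᵒᵖ ⊗ T: it is `torsorAlgebra μ`, the a = ∑
x ⊗ y with ∑ x μ(y) = 1 ⊗ a. Since H is a kernel, tensoring with a flat module preserves its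
description; hence μ takes values in T ⊗ H, which gives δ, and x ⊗ y ↦ x ⊗ δ(y) maps H to H ⊗ H,
which gives Δ. By descent xy lies in k, which gives ε. The antipode comes from convolution: h ↦ 1 ⊗
h is invertible in Hom(H, T ⊗ H), and uniqueness of inverses makes its inverse descend to H
(`exists_antipode`).

With the antipode S, the Grunspan map is given by 1 ⊗ θ(x) = x₍₀₎S(x₍₁₎)⁽²⁾ ⊗ S(x₍₁₎)⁽¹⁾; the
right-hand side is coinvariant in its first factor, so it lies in k ⊗ Tᵒᵖ (`exists_grunspanAux_eq`).
The two axioms follow from h⁽¹⁾ ⊗ θ(h⁽²⁾) = S(h)⁽²⁾ ⊗ S(h)⁽¹⁾ and δθ = (θ ⊗ S²)δ. Uniqueness follows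
by multiplying out the first axiom.

For morphisms, f ⊗ f preserves the equation cutting out the Hopf algebra, so it restricts to the
required g (`exists_bialgHom`). -/

namespace QuantumTorsor

noncomputable section

/-! ### T-linear extensions of maps into T ⊗ X -/

section Extend

variable {k : Type*} [CommRing k] {T : Type*} [Ring T] [Algebra k T]
  {T' : Type*} [Ring T'] [Algebra k T']
  {X Y Z W : Type*} [AddCommGroup X] [Module k X] [AddCommGroup Y] [Module k Y]
  [AddCommGroup Z] [Module k Z] [AddCommGroup W] [Module k W]

/-- The left `T`-linear extension `t ⊗ y ↦ t • φ y` of a map `φ : Y → T ⊗ X`. -/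
def extend (φ : Y →ₗ[k] T ⊗[k] X) : T ⊗[k] Y →ₗ[k] T ⊗[k] X :=
  (LinearMap.mul' k T).rTensor X ∘ₗ (TensorProduct.assoc k T T X).symm.toLinearMap ∘ₗ φ.lTensor T

@[simp]
theorem extend_tmul (φ : Y →ₗ[k] T ⊗[k] X) (t : T) (y : Y) :
    extend φ (t ⊗ₜ y) = t • φ y := by
  simp only [extend, LinearMap.comp_apply, LinearMap.lTensor_tmul, LinearEquiv.coe_coe]
  generalize φ y = z
  induction z with
  | zero => simp
  | add a b ha hb => simp only [TensorProduct.tmul_add, map_add, ha, hb, smul_add]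
  | tmul a x => simp [TensorProduct.smul_tmul']

@[simp]
theorem extend_smul (φ : Y →ₗ[k] T ⊗[k] X) (t : T) (z : T ⊗[k] Y) :
    extend φ (t • z) = t • extend φ z := by
  induction z with
  | zero => simp
  | add a b ha hb => simp only [smul_add, map_add, ha, hb]
  | tmul a x => simp [TensorProduct.smul_tmul', mul_smul]

@[simp]
theorem lTensor_smul (f : Y →ₗ[k] X) (t : T) (z : T ⊗[k] Y) :
    f.lTensor T (t • z) = t • f.lTensor T z := by
  induction z with
  | zero => simp
  | add a b ha hb => simp only [smul_add, map_add, ha, hb]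
  | tmul a x => simp [TensorProduct.smul_tmul']

theorem rTensor_smul (f : T →ₐ[k] T') (t : T) (z : T ⊗[k] Y) :
    f.toLinearMap.rTensor Y (t • z) = f t • f.toLinearMap.rTensor Y z := by
  induction z with
  | zero => simp
  | add a b ha hb => simp only [smul_add, map_add, ha, hb]
  | tmul a x => simp [TensorProduct.smul_tmul']

theorem smul_eq_tmul_one_mul {A : Type*} [Ring A] [Algebra k A] (t : T) (z : T ⊗[k] A) :
    t • z = (t ⊗ₜ[k] (1 : A)) * z := by
  induction z with
  | zero => simp
  | add a b ha hb => simp only [smul_add, mul_add, ha, hb]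
  | tmul a x => simp [TensorProduct.smul_tmul']

theorem extend_extend (φ : Y →ₗ[k] T ⊗[k] X) (ψ : Z →ₗ[k] T ⊗[k] Y) (z : T ⊗[k] Z) :
    extend φ (extend ψ z) = extend (extend φ ∘ₗ ψ) z := by
  induction z with
  | zero => simp
  | add a b ha hb => simp only [map_add, ha, hb]
  | tmul a x => simp

theorem extend_lTensor (φ : Y →ₗ[k] T ⊗[k] X) (ψ : Z →ₗ[k] Y) (z : T ⊗[k] Z) :
    extend φ (ψ.lTensor T z) = extend (φ ∘ₗ ψ) z := by
  induction z with
  | zero => simp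
  | add a b ha hb => simp only [map_add, ha, hb]
  | tmul a x => simp

theorem lTensor_extend (ψ : X →ₗ[k] Z) (φ : Y →ₗ[k] T ⊗[k] X) (z : T ⊗[k] Y) :
    ψ.lTensor T (extend φ z) = extend (ψ.lTensor T ∘ₗ φ) z := by
  induction z with
  | zero => simp
  | add a b ha hb => simp only [map_add, ha, hb]
  | tmul a x => simp

theorem rTensor_extend (f : T →ₐ[k] T') (φ : Y →ₗ[k] T ⊗[k] X) (z : T ⊗[k] Y) :
    f.toLinearMap.rTensor X (extend φ z) =
      extend (f.toLinearMap.rTensor X ∘ₗ φ) (f.toLinearMap.rTensor Y z) := by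
  induction z with
  | zero => simp
  | add a b ha hb => simp only [map_add, ha, hb]
  | tmul a x => simp [rTensor_smul]

theorem extend_mk_one_comp (ψ : Y →ₗ[k] X) (z : T ⊗[k] Y) :
    extend (TensorProduct.mk k T X 1 ∘ₗ ψ) z = ψ.lTensor T z := by
  induction z with
  | zero => simp
  | add a b ha hb => simp only [map_add, ha, hb]
  | tmul a x => simp [TensorProduct.smul_tmul']

theorem extend_mk_one (z : T ⊗[k] X) : extend (TensorProduct.mk k T X 1) z = z := by
  simpa using extend_mk_one_comp (T := T) (LinearMap.id : X →ₗ[k] X) z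

/-- The map `φ ⊗ Z : Y ⊗ Z → T ⊗ (X ⊗ Z)` for `φ : Y → T ⊗ X`. -/
def tensorRight (φ : Y →ₗ[k] T ⊗[k] X) (Z : Type*) [AddCommGroup Z] [Module k Z] :
    Y ⊗[k] Z →ₗ[k] T ⊗[k] (X ⊗[k] Z) :=
  (TensorProduct.assoc k T X Z).toLinearMap ∘ₗ φ.rTensor Z

theorem tensorRight_tmul (φ : Y →ₗ[k] T ⊗[k] X) (y : Y) (z : Z) :
    tensorRight φ Z (y ⊗ₜ z) = TensorProduct.assoc k T X Z (φ y ⊗ₜ z) := rfl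

theorem assoc_smul_tmul (t : T) (w : T ⊗[k] X) (z : Z) :
    TensorProduct.assoc k T X Z ((t • w) ⊗ₜ z) = t • TensorProduct.assoc k T X Z (w ⊗ₜ z) := by
  induction w with
  | zero => simp
  | add a b ha hb => simp only [smul_add, TensorProduct.add_tmul, map_add, ha, hb]
  | tmul a x => simp [TensorProduct.smul_tmul']

theorem extend_tensorRight (φ : Y →ₗ[k] T ⊗[k] X) (ψ : W →ₗ[k] T ⊗[k] Y) (z : W ⊗[k] Z) :
    extend (tensorRight φ Z) (tensorRight ψ Z z) = tensorRight (extend φ ∘ₗ ψ) Z z := by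
  induction z with
  | zero => simp
  | add a b ha hb => simp only [map_add, ha, hb]
  | tmul a x =>
    simp only [tensorRight_tmul, LinearMap.comp_apply]
    generalize ψ a = w
    induction w with
    | zero => simp
    | add a b ha hb => simp only [TensorProduct.add_tmul, map_add, ha, hb]
    | tmul t y => simp [tensorRight_tmul, assoc_smul_tmul]

theorem tensorRight_mk_one_comp (f : Y →ₗ[k] X) (z : Y ⊗[k] Z) :
    tensorRight (TensorProduct.mk k T X 1 ∘ₗ f) Z z = (1 : T) ⊗ₜ f.rTensor Z z := by
  induction z with
  | zero => simp
  | add a b ha hb => simp only [map_add, ha, hb, TensorProduct.tmul_add]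
  | tmul a x => simp [tensorRight_tmul]

theorem tensorRight_mk_one (z : X ⊗[k] Z) :
    tensorRight (TensorProduct.mk k T X 1) Z z = (1 : T) ⊗ₜ z := by
  simpa using tensorRight_mk_one_comp (T := T) (LinearMap.id : X →ₗ[k] X) z

end Extend

/-! ### Faithfully flat descent -/

section Descent

variable {k : Type*} [CommRing k] {T : Type*} [Ring T] [Algebra k T] [Module.FaithfullyFlat k T]
  {X : Type*} [AddCommGroup X] [Module k X]

theorem one_tmul_injective : Function.Injective fun x : X => (1 : T) ⊗ₜ[k] x := by
  intro x y h
  rw [← sub_eq_zero, ← TensorProduct.tmul_sub, Module.FaithfullyFlat.one_tmul_eq_zero_iff,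
    sub_eq_zero] at h
  exact h

/-- Faithfully flat descent for elements. -/
theorem exists_eq_one_tmul (z : T ⊗[k] X)
    (hz : (TensorProduct.mk k T X 1).lTensor T z = (1 : T) ⊗ₜ[k] z) :
    ∃ x : X, z = (1 : T) ⊗ₜ[k] x := by
  have hex : Function.Exact (TensorProduct.mk k T X 1)
      ((TensorProduct.mk k T X 1).lTensor T - TensorProduct.mk k T (T ⊗[k] X) 1) := by
    refine Module.FaithfullyFlat.lTensor_reflects_exact k T _ _ fun y => ⟨fun hy => ?_, ?_⟩
    -- After tensoring with T the sequence is contracted by multiplication: the preimage of t ⊗ s ⊗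
    -- x is ts ⊗ x.
    · refine ⟨extend LinearMap.id y, ?_⟩
      rw [LinearMap.lTensor_sub, LinearMap.sub_apply, sub_eq_zero] at hy
      have h := congrArg (extend (LinearMap.id : T ⊗[k] (T ⊗[k] X) →ₗ[k] _)) hy
      rw [extend_lTensor, extend_lTensor, LinearMap.id_comp, LinearMap.id_comp, extend_mk_one] at h
      rw [lTensor_extend, LinearMap.comp_id, h]
    · rintro ⟨w, rfl⟩
      have h0 : ((TensorProduct.mk k T X 1).lTensor T - TensorProduct.mk k T (T ⊗[k] X) 1) ∘ₗ
          TensorProduct.mk k T X 1 = 0 := LinearMap.ext fun x => by simp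
      rw [← LinearMap.comp_apply, ← LinearMap.lTensor_comp, h0, LinearMap.lTensor_zero,
        LinearMap.zero_apply]
  obtain ⟨x, hx⟩ := (hex z).1 (by simp [hz])
  exact ⟨x, hx.symm⟩

theorem algebraMap_injective_of_faithfullyFlat : Function.Injective (algebraMap k T) := by
  intro a b h
  apply one_tmul_injective (k := k) (T := T)
  simpa [Algebra.algebraMap_eq_smul_one, TensorProduct.smul_tmul] using
    congrArg (fun t : T => t ⊗ₜ[k] (1 : k)) h

end Descent

/-! ### Lifting maps through injections -/

section Lift

variable {k : Type*} [CommRing k]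

theorem exists_algHom_comp_eq {A B C : Type*} [Semiring A] [Algebra k A] [Semiring B] [Algebra k B]
    [Semiring C] [Algebra k C] (i : B →ₐ[k] C) (hi : Function.Injective i) (f : A →ₐ[k] C)
    (h : ∀ a, ∃ b, i b = f a) : ∃ g : A →ₐ[k] B, ∀ a, i (g a) = f a := by
  choose g hg using h
  exact ⟨AlgHom.ofLinearMap
    { toFun := g
      map_add' := fun x y => hi (by simp [hg])
      map_smul' := fun c x => hi (by simp [hg]) } (hi (by simp [hg]))
      fun x y => hi (by simp [hg]), hg⟩

theorem exists_linearMap_comp_eq {A B C : Type*} [AddCommGroup A] [Module k A] [AddCommGroup B]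
    [Module k B] [AddCommGroup C] [Module k C] (i : B →ₗ[k] C) (hi : Function.Injective i)
    (f : A →ₗ[k] C) (h : ∀ a, ∃ b, i b = f a) : ∃ g : A →ₗ[k] B, ∀ a, i (g a) = f a := by
  choose g hg using h
  exact ⟨{ toFun := g
           map_add' := fun x y => hi (by simp [hg])
           map_smul' := fun c x => hi (by simp [hg]) }, hg⟩

end Lift

/-! ### Convolution acting on Hom(C, V) -/

section ConvAction

open Coalgebra

variable {k : Type*} [CommRing k] {C : Type*} [AddCommGroup C] [Module k C] [Coalgebra k C]
  {V : Type*} [AddCommGroup V] [Module k V]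

/-- The convolution action of `Hom(C, End V)` on `Hom(C, V)`. -/
def convAct (φ : C →ₗ[k] Module.End k V) (Z : C →ₗ[k] V) : C →ₗ[k] V :=
  TensorProduct.lift (φ.compl₂ Z) ∘ₗ comul

theorem convAct_apply (φ : C →ₗ[k] Module.End k V) (Z : C →ₗ[k] V) (c : C) :
    convAct φ Z c = TensorProduct.lift (LinearMap.compl₂ φ Z) (comul c) := rfl

/-- This is coassociativity. It lets convolution-inverse maps, such as α and α ∘ S, be cancelled in
identities with values in a module. -/
theorem convAct_convAct (φ ψ : C →ₗ[k] Module.End k V) (Z : C →ₗ[k] V) :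
    convAct φ (convAct ψ Z) =
      convAct (WithConv.toConv φ * WithConv.toConv ψ).ofConv Z := by
  have h1 : TensorProduct.lift (φ.compl₂ (convAct ψ Z)) =
      TensorProduct.lift (φ.compl₂ (TensorProduct.lift (ψ.compl₂ Z))) ∘ₗ
        (comul (R := k) (A := C)).lTensor C := by
    ext a b; simp [convAct]
  have h2 : TensorProduct.lift
        ((WithConv.toConv φ * WithConv.toConv ψ).ofConv.compl₂ Z) =
      TensorProduct.lift (φ.compl₂ (TensorProduct.lift (ψ.compl₂ Z))) ∘ₗ
        (TensorProduct.assoc k C C C).toLinearMap ∘ₗ (comul (R := k) (A := C)).rTensor C := by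
    ext a b
    simp only [TensorProduct.AlgebraTensorModule.curry_apply, LinearMap.restrictScalars_self,
      TensorProduct.curry_apply, TensorProduct.lift.tmul, LinearMap.compl₂_apply,
      LinearMap.comp_apply, LinearMap.rTensor_tmul, LinearMap.convMul_apply]
    generalize comul (R := k) a = z
    induction z with
    | zero => simp
    | add a b ha hb => simp only [TensorProduct.add_tmul, map_add, LinearMap.add_apply, ha, hb]
    | tmul c d => simp
  ext c
  rw [convAct_apply, convAct_apply, h1, h2, LinearMap.comp_apply, LinearMap.comp_apply,
    LinearMap.comp_apply]
  exact congrArg _ (coassoc_apply c).symm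

theorem convAct_one (Z : C →ₗ[k] V) :
    convAct (1 : WithConv (C →ₗ[k] Module.End k V)).ofConv Z = Z := by
  ext c
  have h : TensorProduct.lift
      (LinearMap.compl₂ (1 : WithConv (C →ₗ[k] Module.End k V)).ofConv Z) =
      Z ∘ₗ (TensorProduct.lid k C).toLinearMap ∘ₗ (counit (R := k) (A := C)).rTensor C := by
    ext a b
    simp [LinearMap.convOne_def, Module.algebraMap_end_apply]
  rw [convAct_apply, h]
  simp

end ConvAction

/-! ### Antipode identities -/

section Antipode

open Coalgebra HopfAlgebra WithConv

variable {k : Type*} [CommRing k] {H : Type*} [Ring H] [HopfAlgebra k H]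

theorem algHom_convMul_antipode {A : Type*} [Semiring A] [Algebra k A] (α : H →ₐ[k] A) :
    toConv α.toLinearMap * toConv (α.toLinearMap ∘ₗ antipode k) =
      (1 : WithConv (H →ₗ[k] A)) := by
  have h' := LinearMap.algHom_comp_convMul_distrib α
    (toConv LinearMap.id) (toConv (antipode k (A := H)))
  rw [LinearMap.id_mul_antipode] at h'
  apply WithConv.ofConv_injective
  refine Eq.trans ?_ (h'.symm.trans ?_)
  · simp
  · ext x; simp [LinearMap.convOne_def]

theorem algHom_antipode_convMul {A : Type*} [Semiring A] [Algebra k A] (α : H →ₐ[k] A) :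
    toConv (α.toLinearMap ∘ₗ antipode k) * toConv α.toLinearMap =
      (1 : WithConv (H →ₗ[k] A)) := by
  have h' := LinearMap.algHom_comp_convMul_distrib α
    (toConv (antipode k (A := H))) (toConv LinearMap.id)
  rw [LinearMap.antipode_mul_id] at h'
  apply WithConv.ofConv_injective
  refine Eq.trans ?_ (h'.symm.trans ?_)
  · simp
  · ext x; simp [LinearMap.convOne_def]

/-- Both sides are convolution inverses of Δ. With a(h) = h ⊗ 1 and b(h) = 1 ⊗ h one has Δ = a * b,
whose inverse is (b ∘ S) * (a ∘ S), the flipped map. -/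
theorem comul_antipode (h : H) :
    comul (R := k) (antipode k h) =
      TensorProduct.map (antipode k) (antipode k) (TensorProduct.comm k H H (comul h)) := by
  let a : H →ₐ[k] H ⊗[k] H := Algebra.TensorProduct.includeLeft
  let b : H →ₐ[k] H ⊗[k] H := Algebra.TensorProduct.includeRight
  have hab : toConv (comul (R := k) (A := H)) = toConv a.toLinearMap * toConv b.toLinearMap := by
    apply WithConv.ofConv_injective
    ext x
    rw [LinearMap.convMul_apply]
    generalize comul (R := k) x = z
    induction z with
    | zero => simp
    | add a b ha hb => rw [map_add, map_add, ← ha, ← hb]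
    | tmul c d => simp [a, b]
  have hba : toConv (TensorProduct.map (antipode k) (antipode k) ∘ₗ
        (TensorProduct.comm k H H).toLinearMap ∘ₗ comul (R := k) (A := H)) =
      toConv (b.toLinearMap ∘ₗ antipode k) * toConv (a.toLinearMap ∘ₗ antipode k) := by
    apply WithConv.ofConv_injective
    ext x
    rw [LinearMap.convMul_apply]
    simp only [LinearMap.comp_apply]
    generalize comul (R := k) x = z
    induction z with
    | zero => simp
    | add a b ha hb => rw [map_add, map_add, map_add, map_add, ← ha, ← hb]
    | tmul c d => simp [a, b]
  have hinv : toConv (TensorProduct.map (antipode k) (antipode k) ∘ₗ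
      (TensorProduct.comm k H H).toLinearMap ∘ₗ comul (R := k) (A := H)) *
        toConv (comul (R := k) (A := H)) = 1 := by
    rw [hab, hba, mul_assoc, ← mul_assoc _ (toConv a.toLinearMap), algHom_antipode_convMul,
      one_mul, algHom_antipode_convMul]
  have := left_inv_eq_right_inv hinv (LinearMap.comul_right_inv (R := k) (C := H))
  exact (LinearMap.congr_fun (congrArg WithConv.ofConv this) h).symm

end Antipode

/-! ### Products in Tᵒᵖ ⊗ T under extended maps -/

section Unop

variable {k : Type*} [CommRing k] {T : Type*} [Ring T] [Algebra k T]

variable (k T) in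
/-- The identification `Tᵒᵖ ⊗ T ≃ T ⊗ T`. -/
def unopTensor : Tᵐᵒᵖ ⊗[k] T ≃ₗ[k] T ⊗[k] T :=
  LinearEquiv.rTensor T (MulOpposite.opLinearEquiv k (M := T)).symm

@[simp]
theorem unopTensor_tmul (x : Tᵐᵒᵖ) (y : T) :
    unopTensor k T (x ⊗ₜ y) = x.unop ⊗ₜ[k] y := rfl

@[simp]
theorem mulLeft_tmul (x : Tᵐᵒᵖ) (y : T) : mulLeft k T (x ⊗ₜ y) = x.unop * y := by
  simp [mulLeft]

@[simp]
theorem mulRight_tmul (x : T) (y : Tᵐᵒᵖ) : mulRight k T (x ⊗ₜ y) = x * y.unop := by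
  simp [mulRight]

theorem mulRight_rTensor_assoc_symm (z : T ⊗[k] (Tᵐᵒᵖ ⊗[k] T)) :
    (mulRight k T).rTensor T ((TensorProduct.assoc k T Tᵐᵒᵖ T).symm z) =
      extend (unopTensor k T).toLinearMap z := by
  have : (mulRight k T).rTensor T ∘ₗ (TensorProduct.assoc k T Tᵐᵒᵖ T).symm.toLinearMap =
      extend (unopTensor k T).toLinearMap := by
    ext x y z
    simp [TensorProduct.smul_tmul']
  exact LinearMap.congr_fun this z

variable {X : Type*} [Ring X] [Algebra k X]

theorem extend_unopTensor_mul_tmul (φ : T →ₐ[k] T ⊗[k] X) (a : Tᵐᵒᵖ ⊗[k] T) (x : Tᵐᵒᵖ) (y : T) :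
    extend φ.toLinearMap (unopTensor k T (a * x ⊗ₜ y)) =
      x.unop ⊗ₜ 1 * extend φ.toLinearMap (unopTensor k T a) * φ y := by
  induction a with
  | zero => simp
  | add a b ha hb => simp only [add_mul, mul_add, map_add, ha, hb]
  | tmul c d => simp [smul_eq_tmul_one_mul, ← mul_assoc]

/-- The extension of φ is not multiplicative in general, since the value at a lands between x and
φ(y). When that value is 1 ⊗ c it commutes with x ⊗ 1 and can be pulled out on the left. -/
theorem extend_unopTensor_mul (φ : T →ₐ[k] T ⊗[k] X) {a : Tᵐᵒᵖ ⊗[k] T} {c : X}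
    (ha : extend φ.toLinearMap (unopTensor k T a) = 1 ⊗ₜ c) (b : Tᵐᵒᵖ ⊗[k] T) :
    extend φ.toLinearMap (unopTensor k T (a * b)) =
      1 ⊗ₜ c * extend φ.toLinearMap (unopTensor k T b) := by
  induction b with
  | zero => simp
  | add a b ha hb => simp only [mul_add, map_add, ha, hb]
  | tmul x y =>
    rw [extend_unopTensor_mul_tmul, ha]
    simp [smul_eq_tmul_one_mul, ← mul_assoc]

theorem extend_unopTensor_one (φ : T →ₐ[k] T ⊗[k] X) :
    extend φ.toLinearMap (unopTensor k T 1) = 1 := by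
  simp [Algebra.TensorProduct.one_def]

end Unop

open Coalgebra

/-! ### Translation maps, inverse to the Galois map -/

section Translation

variable {k : Type*} [CommRing k] {T : Type*} [Ring T] [Algebra k T]
  {H : Type*} [Ring H] [Bialgebra k H]

/-- The algebra map `τ : H → Tᵒᵖ ⊗ T` is inverse to the coaction `δ` of the bialgebra `H` on the
comodule algebra `T`, in the sense that `x ⊗ y ↦ x y₍₀₎ ⊗ y₍₁₎` and `x ⊗ h ↦ x τ(h)` are mutually
inverse. -/
structure IsTranslation (δ : T →ₐ[k] T ⊗[k] H) (τ : H →ₐ[k] Tᵐᵒᵖ ⊗[k] T) : Prop where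
  coassoc (x : T) : tensorRight δ.toLinearMap H (δ x) = (comul (R := k) (A := H)).lTensor T (δ x)
  counit (x : T) : (counit (R := k) (A := H)).lTensor T (δ x) = x ⊗ₜ[k] (1 : k)
  extend_coaction (h : H) : extend δ.toLinearMap (unopTensor k T (τ h)) = 1 ⊗ₜ h
  extend_translation (x : T) :
    extend ((unopTensor k T).toLinearMap ∘ₗ τ.toLinearMap) (δ x) = 1 ⊗ₜ x

variable {δ : T →ₐ[k] T ⊗[k] H}

/-- β is injective, and it is multiplicative on products whose left factor it sends into 1 ⊗ H.
Comparing images under β shows that τ respects products and 1. -/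
theorem exists_algHom_translation (τ : H →ₗ[k] T ⊗[k] T)
    (h₁ : ∀ h, extend δ.toLinearMap (τ h) = 1 ⊗ₜ h) (h₂ : ∀ x, extend τ (δ x) = 1 ⊗ₜ x) :
    ∃ τ' : H →ₐ[k] Tᵐᵒᵖ ⊗[k] T, (unopTensor k T).toLinearMap ∘ₗ τ'.toLinearMap = τ := by
  have hinj : Function.Injective fun a => extend δ.toLinearMap (unopTensor k T a) := by
    intro a b hab
    have := congrArg (extend τ) hab
    rw [extend_extend, extend_extend,
      show extend τ ∘ₗ δ.toLinearMap = TensorProduct.mk k T T 1 from LinearMap.ext h₂,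
      extend_mk_one, extend_mk_one] at this
    exact (unopTensor k T).injective this
  let t : H →ₗ[k] Tᵐᵒᵖ ⊗[k] T := (unopTensor k T).symm.toLinearMap ∘ₗ τ
  have ht (h : H) : extend δ.toLinearMap (unopTensor k T (t h)) = 1 ⊗ₜ h := by simp [t, h₁]
  refine ⟨AlgHom.ofLinearMap t (hinj ?_) fun x y => hinj ?_, LinearMap.ext fun h => by simp [t]⟩
  · simp only [ht, extend_unopTensor_one]; rfl
  · simp only [ht, extend_unopTensor_mul δ (ht x)]; simp

namespace IsTranslation

variable {τ : H →ₐ[k] Tᵐᵒᵖ ⊗[k] T} (hτ : IsTranslation δ τ)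

include hτ

theorem extend_translation_extend_coaction (w : T ⊗[k] T) :
    extend ((unopTensor k T).toLinearMap ∘ₗ τ.toLinearMap) (extend δ.toLinearMap w) = w := by
  rw [extend_extend, show _ ∘ₗ δ.toLinearMap = TensorProduct.mk k T T 1 from
    LinearMap.ext hτ.extend_translation, extend_mk_one]

theorem extend_coaction_extend_translation (w : T ⊗[k] H) :
    extend δ.toLinearMap (extend ((unopTensor k T).toLinearMap ∘ₗ τ.toLinearMap) w) = w := by
  rw [extend_extend, show extend δ.toLinearMap ∘ₗ _ = TensorProduct.mk k T H 1 from
    LinearMap.ext hτ.extend_coaction, extend_mk_one]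

theorem lTensor_translation_injective : Function.Injective (τ.toLinearMap.lTensor T) := by
  intro a b hab
  have := congrArg (fun z => extend δ.toLinearMap (extend (unopTensor k T).toLinearMap z)) hab
  simpa only [extend_lTensor, hτ.extend_coaction_extend_translation] using this

/-- Apply T ⊗ ε to β(τ(h)) = 1 ⊗ h: the counit turns β into multiplication. -/
theorem mulLeft_translation (h : H) : mulLeft k T (τ h) = algebraMap k T (Coalgebra.counit h) := by
  have h1 := congrArg ((Coalgebra.counit (R := k) (A := H)).lTensor T) (hτ.extend_coaction h)
  have h2 (w : Tᵐᵒᵖ ⊗[k] T) : (Coalgebra.counit (R := k) (A := H)).lTensor T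
      (extend δ.toLinearMap (unopTensor k T w)) = mulLeft k T w ⊗ₜ 1 := by
    induction w with
    | zero => simp
    | add a b ha hb => simp only [map_add, ha, hb, TensorProduct.add_tmul]
    | tmul a b => simp [hτ.counit, TensorProduct.smul_tmul']
  rw [h2, LinearMap.lTensor_tmul] at h1
  simpa [Algebra.algebraMap_eq_smul_one] using congrArg (TensorProduct.rid k T) h1

/-- `h⁽¹⁾ ⊗ δ(h⁽²⁾) = τ(h₍₁₎) ⊗ h₍₂₎` -/
theorem lTensor_coaction_translation (h : H) :
    δ.toLinearMap.lTensor T (unopTensor k T (τ h)) =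
      tensorRight ((unopTensor k T).toLinearMap ∘ₗ τ.toLinearMap) H (comul (R := k) h) := by
  -- By coassociativity β ⊗ H sends the left side to 1 ⊗ Δ(h); β⁻¹ ⊗ H then recovers the right side.
  have h1 : (extend (tensorRight δ.toLinearMap H)) (δ.toLinearMap.lTensor T (unopTensor k T (τ h)))
      = 1 ⊗ₜ comul (R := k) h := by
    rw [extend_lTensor, show tensorRight δ.toLinearMap H ∘ₗ δ.toLinearMap =
      (comul (R := k) (A := H)).lTensor T ∘ₗ δ.toLinearMap from LinearMap.ext hτ.coassoc,
      ← lTensor_extend, hτ.extend_coaction, LinearMap.lTensor_tmul]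
  have h2 := congrArg
    (extend (tensorRight ((unopTensor k T).toLinearMap ∘ₗ τ.toLinearMap) H)) h1
  have h3 : extend (tensorRight ((unopTensor k T).toLinearMap ∘ₗ τ.toLinearMap) H) ∘ₗ
      tensorRight δ.toLinearMap H = TensorProduct.mk k T (T ⊗[k] H) 1 := by
    refine LinearMap.ext fun z => ?_
    rw [LinearMap.comp_apply, extend_tensorRight, show extend _ ∘ₗ δ.toLinearMap =
      TensorProduct.mk k T T 1 from LinearMap.ext hτ.extend_translation, tensorRight_mk_one]
    rfl
  rw [extend_extend, h3, extend_mk_one] at h2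
  simpa using h2

end IsTranslation

end Translation

section

open Coalgebra WithConv

/-! ### Existence of the antipode -/

section Bialgebra

variable {k : Type*} [CommRing k] {T : Type*} [Ring T] [Algebra k T]
  {H : Type*} [Ring H] [Bialgebra k H] {X : Type*} [AddCommGroup X] [Module k X]

variable (k T H X) in
/-- The action of `H` on `(T ⊗ H) ⊗ X` by left multiplication on the factor `H`. -/
def mulAction : H →ₐ[k] Module.End k ((T ⊗[k] H) ⊗[k] X) :=
  (Algebra.lsmul k k _).comp (Algebra.TensorProduct.includeRight : H →ₐ[k] T ⊗[k] H)

theorem mulAction_apply (h : H) (z : (T ⊗[k] H) ⊗[k] X) :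
    mulAction k T H X h z = ((1 : T) ⊗ₜ[k] h) • z := rfl

variable (k T H) in
/-- The inclusion `T → T ⊗ H`, `x ↦ x ⊗ 1`. -/
def inclLeft : T →ₐ[k] T ⊗[k] H := Algebra.TensorProduct.includeLeft

@[simp]
theorem inclLeft_apply (t : T) : inclLeft k T H t = t ⊗ₜ 1 := rfl

theorem assoc_symm_smul (t : T) (z : T ⊗[k] (H ⊗[k] X)) :
    (TensorProduct.assoc k T H X).symm (t • z) =
      (t ⊗ₜ[k] (1 : H)) • (TensorProduct.assoc k T H X).symm z := by
  induction z with
  | zero => simp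
  | add a b ha hb => simp only [smul_add, map_add, ha, hb]
  | tmul a w =>
    induction w with
    | zero => simp
    | add x y hx hy => simp only [TensorProduct.tmul_add, smul_add, map_add, hx, hy]
    | tmul x y => simp [TensorProduct.smul_tmul']

theorem extend_comul_tmul (Z : H →ₗ[k] (T ⊗[k] H) ⊗[k] X) (t : T) (h : H) :
    extend Z ((TensorProduct.assoc k T H H).symm
        ((comul (R := k) (A := H)).lTensor T (t ⊗ₜ h))) =
      (t ⊗ₜ[k] (1 : H)) • convAct (mulAction k T H X).toLinearMap Z h := by
  rw [LinearMap.lTensor_tmul, convAct_apply]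
  generalize comul (R := k) h = w
  induction w with
  | zero => simp
  | add x y hx hy => simp only [TensorProduct.tmul_add, smul_add, map_add, hx, hy]
  | tmul x y => simp [mulAction_apply, smul_smul]

theorem extend_comul {Z : H →ₗ[k] (T ⊗[k] H) ⊗[k] X} {Y : H →ₗ[k] T ⊗[k] X}
    (hZ : convAct (mulAction k T H X).toLinearMap Z =
      (inclLeft k T H).toLinearMap.rTensor X ∘ₗ Y) (z : T ⊗[k] H) :
    extend Z ((TensorProduct.assoc k T H H).symm ((comul (R := k) (A := H)).lTensor T z)) =
      (inclLeft k T H).toLinearMap.rTensor X (extend Y z) := by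
  induction z with
  | zero => simp
  | add a b ha hb => simp only [map_add, ha, hb]
  | tmul t h => rw [extend_comul_tmul, hZ, extend_tmul, rTensor_smul]; rfl

variable {δ : T →ₐ[k] T ⊗[k] H} {τ : H →ₐ[k] Tᵐᵒᵖ ⊗[k] T}

/-- The map `h ↦ δ(h⁽¹⁾) ⊗ h⁽²⁾`. -/
def coactTranslation (δ : T →ₐ[k] T ⊗[k] H) (τ : H →ₐ[k] Tᵐᵒᵖ ⊗[k] T) :
    H →ₗ[k] (T ⊗[k] H) ⊗[k] T :=
  δ.toLinearMap.rTensor T ∘ₗ (unopTensor k T).toLinearMap ∘ₗ τ.toLinearMap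

/-- Multiplication `(T ⊗ H) ⊗ T → T ⊗ H`. -/
def fold (k T H : Type*) [CommRing k] [Ring T] [Algebra k T] [Ring H] [Bialgebra k H] :
    (T ⊗[k] H) ⊗[k] T →ₗ[k] T ⊗[k] H :=
  LinearMap.mul' k (T ⊗[k] H) ∘ₗ (inclLeft k T H).toLinearMap.lTensor (T ⊗[k] H)

@[simp]
theorem fold_tmul (b : T ⊗[k] H) (t : T) : fold k T H (b ⊗ₜ t) = b * t ⊗ₜ 1 := rfl

theorem fold_smul (b : T ⊗[k] H) (z : (T ⊗[k] H) ⊗[k] T) :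
    fold k T H (b • z) = b * fold k T H z := by
  induction z with
  | zero => simp
  | add x y hx hy => simp only [smul_add, mul_add, map_add, hx, hy]
  | tmul x y => simp [TensorProduct.smul_tmul', mul_assoc]

theorem fold_rTensor_inclLeft (w : Tᵐᵒᵖ ⊗[k] T) :
    fold k T H ((inclLeft k T H).toLinearMap.rTensor T (unopTensor k T w)) =
      mulLeft k T w ⊗ₜ 1 := by
  induction w with
  | zero => simp
  | add x y hx hy => simp only [map_add, hx, hy, TensorProduct.add_tmul]
  | tmul x y => simp

variable (hτ : IsTranslation δ τ)

namespace IsTranslation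

include hτ

/-- `δ(h₍₂₎⁽¹⁾)` multiplied by `h₍₁₎` is `h⁽¹⁾ ⊗ 1 ⊗ h⁽²⁾`. -/
theorem convAct_coactTranslation :
    convAct (mulAction k T H T).toLinearMap (coactTranslation δ τ) =
      (inclLeft k T H).toLinearMap.rTensor T ∘ₗ (unopTensor k T).toLinearMap ∘ₗ
        τ.toLinearMap := by
  -- For w = a ⊗ b, coassociativity collects the expression into a · (δ ⊗ T)(b₍₀₎τ(b₍₁₎)) = a · (δ ⊗
  -- T)(1 ⊗ b). The claim is the case w = τ(h), where β(w) = 1 ⊗ h.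
  have key (w : T ⊗[k] T) : extend (coactTranslation δ τ) ((TensorProduct.assoc k T H H).symm
      ((comul (R := k) (A := H)).lTensor T (extend δ.toLinearMap w))) =
        (inclLeft k T H).toLinearMap.rTensor T w := by
    induction w with
    | zero => simp
    | add x y hx hy => simp only [map_add, hx, hy]
    | tmul a b =>
      rw [extend_tmul, lTensor_smul, assoc_symm_smul, extend_smul, AlgHom.toLinearMap_apply,
        ← hτ.coassoc, tensorRight, LinearMap.comp_apply, LinearEquiv.coe_coe,
        LinearEquiv.symm_apply_apply, coactTranslation, ← rTensor_extend, hτ.extend_translation]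
      simp [TensorProduct.smul_tmul']
  ext h
  have := key (unopTensor k T (τ h))
  rw [hτ.extend_coaction, extend_comul_tmul, ← Algebra.TensorProduct.one_def, one_smul] at this
  exact this

/-- Folding the previous identity gives h⁽¹⁾h⁽²⁾ ⊗ 1 = ε(h): the map s(h) = δ(h⁽¹⁾)(h⁽²⁾ ⊗ 1) is a
right inverse of h ↦ 1 ⊗ h. -/
theorem convMul_fold :
    toConv ((Algebra.TensorProduct.includeRight : H →ₐ[k] T ⊗[k] H).toLinearMap) *
      toConv (fold k T H ∘ₗ coactTranslation δ τ) = (1 : WithConv (H →ₗ[k] T ⊗[k] H)) := by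
  apply WithConv.ofConv_injective
  ext h
  have h1 := congrArg (fold k T H) (LinearMap.congr_fun hτ.convAct_coactTranslation h)
  have h2 : fold k T H ∘ₗ TensorProduct.lift (LinearMap.compl₂ (mulAction k T H T).toLinearMap
      (coactTranslation δ τ)) = LinearMap.mul' k (T ⊗[k] H) ∘ₗ
        TensorProduct.map (Algebra.TensorProduct.includeRight : H →ₐ[k] T ⊗[k] H).toLinearMap
          (fold k T H ∘ₗ coactTranslation δ τ) := by
    ext x y
    simp [mulAction_apply, fold_smul]
  rw [convAct_apply, ← LinearMap.comp_apply, h2] at h1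
  refine h1.trans ?_
  simp [fold_rTensor_inclLeft, hτ.mulLeft_translation, Algebra.TensorProduct.algebraMap_apply]

/-- Since h₍₁₎⁽¹⁾ ⊗ h₍₁₎⁽²⁾ ⊗ h₍₂₎ = h⁽¹⁾ ⊗ δ(h⁽²⁾), the product is δ(h⁽¹⁾)δ(h⁽²⁾) = δ(h⁽¹⁾h⁽²⁾) =
ε(h). -/
theorem fold_convMul :
    toConv (fold k T H ∘ₗ coactTranslation δ τ) *
      toConv ((Algebra.TensorProduct.includeRight : H →ₐ[k] T ⊗[k] H).toLinearMap) =
        (1 : WithConv (H →ₗ[k] T ⊗[k] H)) := by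
  apply WithConv.ofConv_injective
  ext h
  let K : T ⊗[k] (T ⊗[k] H) →ₗ[k] T ⊗[k] H :=
    LinearMap.mul' k (T ⊗[k] H) ∘ₗ δ.toLinearMap.rTensor (T ⊗[k] H)
  have h1 : K ∘ₗ tensorRight ((unopTensor k T).toLinearMap ∘ₗ τ.toLinearMap) H =
      LinearMap.mul' k (T ⊗[k] H) ∘ₗ TensorProduct.map (fold k T H ∘ₗ coactTranslation δ τ)
        (Algebra.TensorProduct.includeRight : H →ₐ[k] T ⊗[k] H).toLinearMap := by
    ext x y
    simp only [TensorProduct.AlgebraTensorModule.curry_apply, LinearMap.restrictScalars_self,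
      TensorProduct.curry_apply, LinearMap.comp_apply, TensorProduct.map_tmul, tensorRight_tmul,
      coactTranslation]
    generalize (unopTensor k T).toLinearMap (τ.toLinearMap x) = w
    induction w with
    | zero => simp
    | add a b ha hb => simp only [TensorProduct.add_tmul, map_add, ha, hb]
    | tmul a b => simp [K, mul_assoc]
  have h2 (w : Tᵐᵒᵖ ⊗[k] T) :
      K (δ.toLinearMap.lTensor T (unopTensor k T w)) = δ (mulLeft k T w) := by
    induction w with
    | zero => simp
    | add a b ha hb => simp only [map_add, ha, hb]
    | tmul a b => simp [K]
  have h3 := h2 (τ h)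
  rw [hτ.lTensor_coaction_translation, ← LinearMap.comp_apply, h1, hτ.mulLeft_translation] at h3
  refine h3.trans ?_
  simp

theorem exists_antipode [Module.FaithfullyFlat k T] : ∃ S : H →ₗ[k] H,
    toConv S * toConv LinearMap.id = 1 ∧ toConv LinearMap.id * toConv S = 1 := by
  set s := fold k T H ∘ₗ coactTranslation δ τ with hs
  let j : H →ₐ[k] T ⊗[k] H := Algebra.TensorProduct.includeRight
  let i₁ : T ⊗[k] H →ₐ[k] T ⊗[k] (T ⊗[k] H) := Algebra.TensorProduct.includeRight
  let i₂ : T ⊗[k] H →ₐ[k] T ⊗[k] (T ⊗[k] H) := Algebra.TensorProduct.map (AlgHom.id k T) j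
  -- The two maps T ⊗ H ⇉ T ⊗ T ⊗ H of the descent diagram agree on j, so i₁ ∘ s and i₂ ∘ s are
  -- inverses of one element and coincide. Hence s takes values in 1 ⊗ H.
  have hi : i₁.toLinearMap ∘ₗ j.toLinearMap = i₂.toLinearMap ∘ₗ j.toLinearMap := by
    ext h; simp [i₁, i₂, j]
  have hone (i : T ⊗[k] H →ₐ[k] T ⊗[k] (T ⊗[k] H)) :
      toConv (i.toLinearMap ∘ₗ (1 : WithConv (H →ₗ[k] T ⊗[k] H)).ofConv) = 1 := by
    apply WithConv.ofConv_injective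
    ext h; exact i.commutes (Coalgebra.counit h)
  have e₁ : toConv (i₁.toLinearMap ∘ₗ s) * toConv (i₁.toLinearMap ∘ₗ j.toLinearMap) = 1 := by
    have := LinearMap.algHom_comp_convMul_distrib i₁ (toConv s) (toConv j.toLinearMap)
    rw [hτ.fold_convMul] at this
    rw [← hone i₁]
    exact (congrArg toConv this).symm
  have e₂ : toConv (i₂.toLinearMap ∘ₗ j.toLinearMap) * toConv (i₂.toLinearMap ∘ₗ s) = 1 := by
    have := LinearMap.algHom_comp_convMul_distrib i₂ (toConv j.toLinearMap) (toConv s)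
    rw [hτ.convMul_fold] at this
    rw [← hone i₂]
    exact (congrArg toConv this).symm
  rw [← hi] at e₂
  have e := left_inv_eq_right_inv e₁ e₂
  have hjinj : Function.Injective j := one_tmul_injective
  obtain ⟨S, hS⟩ := exists_linearMap_comp_eq j.toLinearMap hjinj s fun h => by
    obtain ⟨x, hx⟩ := exists_eq_one_tmul (s h)
      (LinearMap.congr_fun (congrArg WithConv.ofConv e) h).symm
    exact ⟨x, hx.symm⟩
  have hjS : j.toLinearMap ∘ₗ S = s := LinearMap.ext hS
  refine ⟨S, WithConv.ofConv_injective (LinearMap.ext fun h => hjinj ?_),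
    WithConv.ofConv_injective (LinearMap.ext fun h => hjinj ?_)⟩
  · have h1 := LinearMap.algHom_comp_convMul_distrib j (toConv S) (toConv LinearMap.id)
    have h2 := congrArg WithConv.ofConv hτ.fold_convMul
    rw [← hs, ← hjS] at h2
    refine (LinearMap.congr_fun (h1.trans h2) h).trans ?_
    simp [LinearMap.convOne_def]
  · have h1 := LinearMap.algHom_comp_convMul_distrib j (toConv LinearMap.id) (toConv S)
    have h2 := congrArg WithConv.ofConv hτ.convMul_fold
    rw [← hs, ← hjS] at h2
    refine (LinearMap.congr_fun (h1.trans h2) h).trans ?_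
    simp [LinearMap.convOne_def]

end IsTranslation

end Bialgebra

end

section

open Coalgebra WithConv HopfAlgebra

/-! ### Construction of the Grunspan map -/

section Hopf

variable {k : Type*} [CommRing k] {T : Type*} [Ring T] [Algebra k T]
  {H : Type*} [Ring H] [HopfAlgebra k H]
  {δ : T →ₐ[k] T ⊗[k] H} {τ : H →ₐ[k] Tᵐᵒᵖ ⊗[k] T}

/-- The map `h ↦ S(h)⁽²⁾ ⊗ S(h)⁽¹⁾`. -/
def flipTranslation (τ : H →ₐ[k] Tᵐᵒᵖ ⊗[k] T) : H →ₗ[k] T ⊗[k] Tᵐᵒᵖ :=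
  (TensorProduct.comm k Tᵐᵒᵖ T).toLinearMap ∘ₗ τ.toLinearMap ∘ₗ antipode k

theorem flipTranslation_apply (h : H) :
    flipTranslation τ h = Algebra.TensorProduct.comm k Tᵐᵒᵖ T (τ (antipode k h)) := rfl

theorem flipTranslation_mul (g h : H) :
    flipTranslation τ (g * h) = flipTranslation τ h * flipTranslation τ g := by
  simp only [flipTranslation_apply, antipode_mul_antidistrib, map_mul]

/-- The map `x ↦ x₍₀₎ S(x₍₁₎)⁽²⁾ ⊗ S(x₍₁₎)⁽¹⁾`. -/
def grunspanAux (δ : T →ₐ[k] T ⊗[k] H) (τ : H →ₐ[k] Tᵐᵒᵖ ⊗[k] T) : T →ₗ[k] T ⊗[k] Tᵐᵒᵖ :=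
  extend (flipTranslation τ) ∘ₗ δ.toLinearMap

/-- Antimultiplicativity of S and of the flip nests the contribution of w inside that of z. Being of
the form 1 ⊗ t, it passes out on the left; this makes θ multiplicative. -/
theorem extend_flipTranslation_mul (z w : T ⊗[k] H) {t : T}
    (hw : extend (flipTranslation τ) w = 1 ⊗ₜ MulOpposite.op t) :
    extend (flipTranslation τ) (z * w) =
      1 ⊗ₜ MulOpposite.op t * extend (flipTranslation τ) z := by
  have key (s : T) (h : H) : extend (flipTranslation τ) (s ⊗ₜ h * w) =
      s ⊗ₜ 1 * extend (flipTranslation τ) w * flipTranslation τ h := by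
    clear hw
    induction w with
    | zero => simp
    | add a b ha hb => simp only [mul_add, add_mul, map_add, ha, hb]
    | tmul a b =>
      simp only [Algebra.TensorProduct.tmul_mul_tmul, extend_tmul, smul_eq_tmul_one_mul,
        flipTranslation_mul, ← mul_assoc, one_mul]
  induction z with
  | zero => simp
  | add a b ha hb => simp only [mul_add, add_mul, map_add, ha, hb]
  | tmul s h =>
    rw [key, hw, extend_tmul, smul_eq_tmul_one_mul, ← mul_assoc]
    simp

namespace IsTranslation

variable (hτ : IsTranslation δ τ)

include hτ

/-- `δ(h⁽¹⁾) ⊗ h⁽²⁾ = h₍₂₎⁽¹⁾ ⊗ S(h₍₁₎) ⊗ h₍₂₎⁽²⁾` -/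
theorem coactTranslation_eq : coactTranslation δ τ =
    convAct ((mulAction k T H T).toLinearMap ∘ₗ antipode k)
      ((inclLeft k T H).toLinearMap.rTensor T ∘ₗ (unopTensor k T).toLinearMap ∘ₗ
        τ.toLinearMap) := by
  rw [← hτ.convAct_coactTranslation, convAct_convAct, algHom_antipode_convMul, convAct_one]

/-- Use h⁽¹⁾ ⊗ δ(h⁽²⁾) = τ(h₍₁₎) ⊗ h₍₂₎ at S(h); as S reverses Δ, the factor produced in H is
S(h₍₁₎). -/
theorem rTensor_flipTranslation : δ.toLinearMap.rTensor Tᵐᵒᵖ ∘ₗ flipTranslation τ =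
    convAct ((mulAction k T H Tᵐᵒᵖ).toLinearMap ∘ₗ antipode k)
      ((inclLeft k T H).toLinearMap.rTensor Tᵐᵒᵖ ∘ₗ flipTranslation τ) := by
  let N : T ⊗[k] (T ⊗[k] H) →ₗ[k] (T ⊗[k] H) ⊗[k] Tᵐᵒᵖ :=
    (MulOpposite.opLinearEquiv k (M := T)).toLinearMap.lTensor (T ⊗[k] H) ∘ₗ
      (TensorProduct.comm k T (T ⊗[k] H)).toLinearMap
  have h1 (w : Tᵐᵒᵖ ⊗[k] T) : δ.toLinearMap.rTensor Tᵐᵒᵖ (TensorProduct.comm k Tᵐᵒᵖ T w) =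
      N (δ.toLinearMap.lTensor T (unopTensor k T w)) := by
    induction w with
    | zero => simp
    | add a b ha hb => simp only [map_add, ha, hb]
    | tmul a b => simp [N]
  have h2 (g : H) (w : Tᵐᵒᵖ ⊗[k] T) :
      N (TensorProduct.assoc k T T H (unopTensor k T w ⊗ₜ g)) =
        ((1 : T) ⊗ₜ[k] g) • (inclLeft k T H).toLinearMap.rTensor Tᵐᵒᵖ
          (TensorProduct.comm k Tᵐᵒᵖ T w) := by
    induction w with
    | zero => simp
    | add a b ha hb => simp only [map_add, TensorProduct.add_tmul, smul_add, ha, hb]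
    | tmul a b => simp [N, TensorProduct.smul_tmul']
  ext h
  rw [convAct_apply, flipTranslation, LinearMap.comp_apply, LinearMap.comp_apply,
    LinearMap.comp_apply, LinearEquiv.coe_coe, h1, AlgHom.toLinearMap_apply,
    hτ.lTensor_coaction_translation, comul_antipode]
  generalize comul (R := k) h = z
  induction z with
  | zero => simp
  | add a b ha hb => simp only [map_add, ha, hb]
  | tmul a b =>
    simp only [TensorProduct.comm_tmul, TensorProduct.map_tmul, tensorRight_tmul,
      LinearMap.comp_apply, TensorProduct.lift.tmul, LinearMap.compl₂_apply, LinearEquiv.coe_coe,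
      AlgHom.toLinearMap_apply, h2, mulAction_apply]

/-- Coacting on x₍₀₎ yields x₍₁₎ and coacting on the flipped translation yields S(x₍₂₎); these
cancel, leaving a coinvariant first factor. -/
theorem rTensor_grunspanAux (x : T) : δ.toLinearMap.rTensor Tᵐᵒᵖ (grunspanAux δ τ x) =
    (inclLeft k T H).toLinearMap.rTensor Tᵐᵒᵖ (grunspanAux δ τ x) := by
  have hc : δ.toLinearMap.rTensor H (δ x) =
      (TensorProduct.assoc k T H H).symm ((comul (R := k) (A := H)).lTensor T (δ x)) := by
    rw [← hτ.coassoc, tensorRight, LinearMap.comp_apply, LinearEquiv.coe_coe,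
      LinearEquiv.symm_apply_apply]
  rw [grunspanAux, LinearMap.comp_apply, rTensor_extend, AlgHom.toLinearMap_apply, hc]
  refine extend_comul ?_ _
  rw [hτ.rTensor_flipTranslation, convAct_convAct, algHom_convMul_antipode, convAct_one]

/-- Flatness of Tᵒᵖ preserves the description of k as the kernel of δ − (– ⊗ 1), so coinvariance in
the first factor puts the element in k ⊗ Tᵒᵖ. -/
theorem exists_grunspanAux_eq [Module.FaithfullyFlat k T]
    (hco : ∀ x : T, δ x = x ⊗ₜ[k] (1 : H) ↔ x ∈ Set.range (algebraMap k T)) :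
    ∃ θ : T →ₐ[k] T, ∀ x, grunspanAux δ τ x = 1 ⊗ₜ MulOpposite.op (θ x) := by
  have : Module.Flat k Tᵐᵒᵖ := Module.Flat.of_linearEquiv (MulOpposite.opLinearEquiv k (M := T)).symm
  have hex : Function.Exact (Algebra.linearMap k T)
      (δ.toLinearMap - (inclLeft k T H).toLinearMap) := fun x => by
    rw [LinearMap.sub_apply, sub_eq_zero]
    exact hco x
  have hex' := Module.Flat.rTensor_exact Tᵐᵒᵖ hex
  let i : T →ₗ[k] T ⊗[k] Tᵐᵒᵖ :=
    TensorProduct.mk k T Tᵐᵒᵖ 1 ∘ₗ (MulOpposite.opLinearEquiv k (M := T)).toLinearMap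
  have hi : Function.Injective i := (one_tmul_injective (k := k) (T := T)).comp
    (MulOpposite.opLinearEquiv k (M := T)).injective
  obtain ⟨θ, hθ⟩ := exists_linearMap_comp_eq i hi (grunspanAux δ τ) fun x => by
    obtain ⟨w, hw⟩ := (hex' (grunspanAux δ τ x)).1
      (by rw [LinearMap.rTensor_sub, LinearMap.sub_apply, hτ.rTensor_grunspanAux, sub_self])
    refine ⟨(TensorProduct.lid k Tᵐᵒᵖ w).unop, ?_⟩
    rw [← hw]
    clear hw
    induction w with
    | zero => simp
    | add a b ha hb => simp only [map_add, MulOpposite.unop_add, ha, hb]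
    | tmul a b => simp [i, Algebra.algebraMap_eq_smul_one, TensorProduct.smul_tmul]
  refine ⟨AlgHom.ofLinearMap θ (hi ?_) fun x y => hi ?_, fun x => (hθ x).symm⟩
  · rw [hθ, grunspanAux]
    simp [Algebra.TensorProduct.one_def, i, flipTranslation]
  · have hm := extend_flipTranslation_mul (δ x) (δ y) (t := θ y) (hθ y).symm
    have hx : extend (flipTranslation τ) (δ x) = i (θ x) := (hθ x).symm
    rw [hθ, grunspanAux, LinearMap.comp_apply, AlgHom.toLinearMap_apply, map_mul, hm, hx]
    simp [i]

section Theta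

variable {θ : T →ₐ[k] T} (hθ : ∀ x, grunspanAux δ τ x = 1 ⊗ₜ MulOpposite.op (θ x))

include hθ

/-- `h⁽¹⁾ ⊗ θ(h⁽²⁾) = S(h)⁽²⁾ ⊗ S(h)⁽¹⁾` -/
theorem lTensor_theta_translation (h : H) :
    ((MulOpposite.opLinearEquiv k (M := T)).toLinearMap ∘ₗ θ.toLinearMap).lTensor T
      (unopTensor k T (τ h)) = flipTranslation τ h := by
  -- The defining formula of θ factors the left side through β(τ(h)) = 1 ⊗ h.
  have h1 : TensorProduct.mk k T Tᵐᵒᵖ 1 ∘ₗ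
      (MulOpposite.opLinearEquiv k (M := T)).toLinearMap ∘ₗ θ.toLinearMap =
        extend (flipTranslation τ) ∘ₗ δ.toLinearMap := LinearMap.ext fun x => (hθ x).symm
  rw [← extend_mk_one_comp, h1, ← extend_extend, hτ.extend_coaction]
  simp

/-- `δ(θ(x)) = θ(x₍₀₎) ⊗ S²(x₍₁₎)` -/
theorem coaction_theta [Module.FaithfullyFlat k T] (x : T) :
    δ (θ x) = TensorProduct.map θ.toLinearMap (antipode k ∘ₗ antipode k) (δ x) := by
  apply one_tmul_injective (k := k) (T := T)
  let ψ : Tᵐᵒᵖ →ₗ[k] T ⊗[k] H :=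
    δ.toLinearMap ∘ₗ (MulOpposite.opLinearEquiv k (M := T)).symm.toLinearMap
  let ρ : H →ₗ[k] T ⊗[k] T :=
    (MulOpposite.opLinearEquiv k (M := T)).symm.toLinearMap.lTensor T ∘ₗ flipTranslation τ
  let c : T ⊗[k] H →ₗ[k] H ⊗[k] T := (TensorProduct.comm k T H).toLinearMap
  have hρδ : extend ρ ∘ₗ δ.toLinearMap = TensorProduct.mk k T T 1 ∘ₗ θ.toLinearMap := by
    ext y
    simp only [ρ, LinearMap.comp_apply]
    rw [← lTensor_extend]
    have := hθ y
    rw [grunspanAux, LinearMap.comp_apply] at this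
    rw [this]
    simp
  -- Here `coactTranslation_eq` is evaluated at S(h). Since S reverses Δ, the factor in H is S
  -- applied to S(h₍₂₎), the source of S².
  have hψρ : ψ.lTensor T ∘ₗ flipTranslation τ =
      tensorRight ρ H ∘ₗ (antipode k ∘ₗ antipode k).lTensor H ∘ₗ comul := by
    let N : (T ⊗[k] H) ⊗[k] T →ₗ[k] T ⊗[k] (T ⊗[k] H) :=
      (TensorProduct.comm k (T ⊗[k] H) T).toLinearMap
    have h1 (w : Tᵐᵒᵖ ⊗[k] T) : ψ.lTensor T (TensorProduct.comm k Tᵐᵒᵖ T w) =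
        N (δ.toLinearMap.rTensor T (unopTensor k T w)) := by
      induction w with
      | zero => simp
      | add a b ha hb => simp only [map_add, ha, hb]
      | tmul a b => simp [N, ψ]
    have h2 (g : H) (w : Tᵐᵒᵖ ⊗[k] T) : N (((1 : T) ⊗ₜ[k] g) •
        (inclLeft k T H).toLinearMap.rTensor T (unopTensor k T w)) =
          TensorProduct.assoc k T T H
            ((MulOpposite.opLinearEquiv k (M := T)).symm.toLinearMap.lTensor T
              (TensorProduct.comm k Tᵐᵒᵖ T w) ⊗ₜ g) := by
      induction w with
      | zero => simp
      | add a b ha hb => simp only [map_add, TensorProduct.add_tmul, smul_add, ha, hb]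
      | tmul a b => simp [N, TensorProduct.smul_tmul']
    ext h
    have h3 := LinearMap.congr_fun hτ.coactTranslation_eq (antipode k h)
    rw [coactTranslation, LinearMap.comp_apply, LinearMap.comp_apply, convAct_apply,
      comul_antipode] at h3
    rw [LinearMap.comp_apply, flipTranslation, LinearMap.comp_apply, LinearMap.comp_apply,
      LinearEquiv.coe_coe, h1]
    refine (congrArg N h3).trans ?_
    rw [LinearMap.comp_apply, LinearMap.comp_apply]
    generalize comul (R := k) h = z
    induction z with
    | zero => simp
    | add a b ha hb => simp only [map_add, ha, hb]
    | tmul a b =>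
      simp only [TensorProduct.comm_tmul, TensorProduct.map_tmul, tensorRight_tmul,
        LinearMap.comp_apply, TensorProduct.lift.tmul, LinearMap.compl₂_apply, LinearEquiv.coe_coe,
        AlgHom.toLinearMap_apply, h2, mulAction_apply, LinearMap.lTensor_tmul, ρ, flipTranslation]
  have h1 := congrArg (ψ.lTensor T) (hθ x)
  rw [LinearMap.lTensor_tmul, grunspanAux, LinearMap.comp_apply, lTensor_extend, hψρ] at h1
  refine Eq.trans h1.symm ?_
  rw [← extend_lTensor, LinearMap.lTensor_comp, LinearMap.comp_apply, AlgHom.toLinearMap_apply,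
    ← hτ.coassoc]
  have h2 (w : T ⊗[k] H) : ((antipode k ∘ₗ antipode k).lTensor H).lTensor T
      (tensorRight δ.toLinearMap H w) =
        tensorRight δ.toLinearMap H ((antipode k ∘ₗ antipode k).lTensor T w) := by
    induction w with
    | zero => simp
    | add a b ha hb => simp only [map_add, ha, hb]
    | tmul a b =>
      rw [LinearMap.lTensor_tmul, tensorRight_tmul, tensorRight_tmul]
      generalize δ.toLinearMap a = v
      induction v with
      | zero => simp
      | add a b ha hb => simp only [TensorProduct.add_tmul, map_add, ha, hb]
      | tmul a b => simp
  rw [h2, extend_tensorRight, hρδ, tensorRight_mk_one_comp, ← LinearMap.comp_apply,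
    LinearMap.rTensor_comp_lTensor]

end Theta

end IsTranslation

end Hopf

end

section

open Coalgebra HopfAlgebra

/-! ### The torsor of a translation map -/

section Torsor

variable {k : Type*} [CommRing k] {T : Type*} [Ring T] [Algebra k T]
  {H : Type*} [Ring H] [Bialgebra k H]

/-- The map `x ↦ x₍₀₎ ⊗ τ(x₍₁₎)`. -/
def torsorMu (δ : T →ₐ[k] T ⊗[k] H) (τ : H →ₐ[k] Tᵐᵒᵖ ⊗[k] T) :
    T →ₐ[k] T ⊗[k] (Tᵐᵒᵖ ⊗[k] T) :=
  (Algebra.TensorProduct.map (AlgHom.id k T) τ).comp δ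

variable {δ : T →ₐ[k] T ⊗[k] H} {τ : H →ₐ[k] Tᵐᵒᵖ ⊗[k] T}

theorem torsorMu_apply (x : T) : torsorMu δ τ x = τ.toLinearMap.lTensor T (δ x) := rfl

/-- The map `g ⊗ h ↦ τ(g) ⊗ τ(h)`. -/
def doubleTranslation (τ : H →ₐ[k] Tᵐᵒᵖ ⊗[k] T) :
    H ⊗[k] H →ₗ[k] Tᵐᵒᵖ ⊗[k] (T ⊗[k] (Tᵐᵒᵖ ⊗[k] T)) :=
  (TensorProduct.assoc k Tᵐᵒᵖ T (Tᵐᵒᵖ ⊗[k] T)).toLinearMap ∘ₗ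
    TensorProduct.map τ.toLinearMap τ.toLinearMap

namespace IsTranslation

variable (hτ : IsTranslation δ τ)

include hτ

theorem flattenLeft_torsorMu (x : T) :
    flattenLeft k T ((torsorMu δ τ).toLinearMap.rTensor (Tᵐᵒᵖ ⊗[k] T) (torsorMu δ τ x)) =
      (doubleTranslation τ ∘ₗ comul).lTensor T (δ x) := by
  have key (z : T ⊗[k] H) : flattenLeft k T ((torsorMu δ τ).toLinearMap.rTensor (Tᵐᵒᵖ ⊗[k] T)
      (τ.toLinearMap.lTensor T z)) =
        (doubleTranslation τ).lTensor T (tensorRight δ.toLinearMap H z) := by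
    induction z with
    | zero => simp
    | add a b ha hb => simp only [map_add, ha, hb]
    | tmul t h =>
      simp only [LinearMap.lTensor_tmul, LinearMap.rTensor_tmul, tensorRight_tmul,
        AlgHom.toLinearMap_apply, torsorMu_apply]
      generalize δ t = v
      induction v with
      | zero => simp
      | add a b ha hb => simp only [TensorProduct.add_tmul, map_add, ha, hb]
      | tmul a b => simp [flattenLeft, doubleTranslation]
  rw [torsorMu_apply, key, hτ.coassoc, LinearMap.lTensor_comp, LinearMap.comp_apply]

/-- Both sides of coassociativity equal x₍₀₎ ⊗ τ(x₍₁₎) ⊗ τ(x₍₂₎): one by coassociativity of δ, the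
other by h⁽¹⁾ ⊗ δ(h⁽²⁾) = τ(h₍₁₎) ⊗ h₍₂₎. -/
theorem isTorsor : IsTorsor (torsorMu δ τ) where
  coassoc := by
    ext x
    simp only [LinearMap.comp_apply, AlgHom.toLinearMap_apply]
    rw [hτ.flattenLeft_torsorMu, torsorMu_apply, ← LinearMap.comp_apply (g := τ.toLinearMap.lTensor T),
      ← LinearMap.lTensor_comp]
    congr 2
    ext h
    let O : T ⊗[k] (T ⊗[k] H) →ₗ[k] Tᵐᵒᵖ ⊗[k] (T ⊗[k] (Tᵐᵒᵖ ⊗[k] T)) :=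
      TensorProduct.map (MulOpposite.opLinearEquiv k (M := T)).toLinearMap
        (τ.toLinearMap.lTensor T)
    have h1 (w : Tᵐᵒᵖ ⊗[k] T) : (torsorMu δ τ).toLinearMap.lTensor Tᵐᵒᵖ w =
        O (δ.toLinearMap.lTensor T (unopTensor k T w)) := by
      induction w with
      | zero => simp
      | add a b ha hb => simp only [map_add, ha, hb]
      | tmul a b => simp [O, torsorMu_apply]
    have h2 : O ∘ₗ tensorRight ((unopTensor k T).toLinearMap ∘ₗ τ.toLinearMap) H =
        doubleTranslation τ := by
      ext x y
      simp only [TensorProduct.AlgebraTensorModule.curry_apply, LinearMap.restrictScalars_self,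
        TensorProduct.curry_apply, LinearMap.comp_apply, tensorRight_tmul, doubleTranslation,
        TensorProduct.map_tmul, LinearEquiv.coe_coe]
      generalize τ.toLinearMap x = v
      induction v with
      | zero => simp
      | add a b ha hb => simp only [TensorProduct.add_tmul, map_add, ha, hb]
      | tmul a b => simp [O]
    simp only [LinearMap.comp_apply, AlgHom.toLinearMap_apply]
    rw [h1, hτ.lTensor_coaction_translation]
    exact (LinearMap.congr_fun h2 _).symm
  mul_left x := by
    have h1 : mulLeft k T ∘ₗ τ.toLinearMap =
        Algebra.linearMap k T ∘ₗ Coalgebra.counit :=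
      LinearMap.ext hτ.mulLeft_translation
    rw [torsorMu_apply, ← LinearMap.comp_apply, ← LinearMap.lTensor_comp, h1,
      LinearMap.lTensor_comp, LinearMap.comp_apply, hτ.counit]
    simp
  mul_right x := by
    rw [mulRight_rTensor_assoc_symm, torsorMu_apply, extend_lTensor, hτ.extend_translation]

end IsTranslation

end Torsor

/-! ### Morphisms of torsors and of Galois objects -/

section Hom

variable {k : Type*} [CommRing k] {T : Type*} [Ring T] [Algebra k T]
  {H : Type*} [Ring H] [Bialgebra k H] {T' : Type*} [Ring T'] [Algebra k T']
  {H' : Type*} [Ring H'] [Bialgebra k H']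
  {δ : T →ₐ[k] T ⊗[k] H} {τ : H →ₐ[k] Tᵐᵒᵖ ⊗[k] T}
  {δ' : T' →ₐ[k] T' ⊗[k] H'} {τ' : H' →ₐ[k] T'ᵐᵒᵖ ⊗[k] T'}

/-- The algebra map `f ⊗ f : Tᵒᵖ ⊗ T → T'ᵒᵖ ⊗ T'`. -/
def opMap (f : T →ₐ[k] T') : Tᵐᵒᵖ ⊗[k] T →ₐ[k] T'ᵐᵒᵖ ⊗[k] T' :=
  Algebra.TensorProduct.map (AlgHom.op f) f

@[simp]
theorem opMap_tmul (f : T →ₐ[k] T') (x : Tᵐᵒᵖ) (y : T) :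
    opMap f (x ⊗ₜ y) = MulOpposite.op (f x.unop) ⊗ₜ f y := rfl

theorem tripleMap_tmul (f : T →ₐ[k] T') (x : T) (y : Tᵐᵒᵖ ⊗[k] T) :
    tripleMap f (x ⊗ₜ y) = f x ⊗ₜ opMap f y := rfl

namespace IsTranslation

variable (hτ : IsTranslation δ τ) (hτ' : IsTranslation δ' τ')

include hτ hτ'

/-- Both sides have image 1 ⊗ g(h) under β'. Asking only linearity of g allows g = S², needed for
the Grunspan map. -/
theorem opMap_translation {f : T →ₐ[k] T'} {g : H →ₗ[k] H'}
    (hfg : ∀ x, TensorProduct.map f.toLinearMap g (δ x) = δ' (f x)) (h : H) :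
    opMap f (τ h) = τ' (g h) := by
  have h1 (w : Tᵐᵒᵖ ⊗[k] T) : extend δ'.toLinearMap (unopTensor k T' (opMap f w)) =
      TensorProduct.map f.toLinearMap g (extend δ.toLinearMap (unopTensor k T w)) := by
    induction w with
    | zero => simp
    | add a b ha hb => simp only [map_add, ha, hb]
    | tmul a b =>
      simp only [opMap_tmul, unopTensor_tmul, extend_tmul, MulOpposite.unop_op,
        AlgHom.toLinearMap_apply, ← hfg]
      generalize δ b = v
      induction v with
      | zero => simp
      | add a b ha hb => simp only [smul_add, map_add, ha, hb]
      | tmul a b => simp [TensorProduct.smul_tmul']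
  apply (unopTensor k T').injective
  rw [← hτ'.extend_translation_extend_coaction (unopTensor k T' (opMap f (τ h))), h1,
    hτ.extend_coaction]
  simp

theorem isTorsorHom_of_linearMap {f : T →ₐ[k] T'} {g : H →ₗ[k] H'}
    (hfg : ∀ x, TensorProduct.map f.toLinearMap g (δ x) = δ' (f x)) :
    IsTorsorHom (torsorMu δ τ) (torsorMu δ' τ') f := by
  refine AlgHom.ext fun x => ?_
  rw [AlgHom.comp_apply, AlgHom.comp_apply, torsorMu_apply, torsorMu_apply, ← hfg]
  generalize δ x = z
  induction z with
  | zero => simp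
  | add a b ha hb => simp only [map_add, ha, hb]
  | tmul t h => simp [tripleMap_tmul, hτ.opMap_translation hτ' hfg]

end IsTranslation

namespace IsTranslation

theorem translation_injective [Module.FaithfullyFlat k T] (hτ : IsTranslation δ τ) :
    Function.Injective τ := fun g h hgh => by
  apply one_tmul_injective (k := k) (T := T)
  simp only [← hτ.extend_coaction, hgh]

theorem extend_torsorMu_translation (hτ : IsTranslation δ τ) (h : H) :
    extend (torsorMu δ τ).toLinearMap (unopTensor k T (τ h)) = 1 ⊗ₜ τ h := by
  rw [show (torsorMu δ τ).toLinearMap = τ.toLinearMap.lTensor T ∘ₗ δ.toLinearMap from rfl,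
    ← lTensor_extend, hτ.extend_coaction]
  simp

/-- Applying T ⊗ β to the hypothesis says that β(a) satisfies the descent condition, so β(a) = 1 ⊗
h. Thus H is recovered from μ alone, as a subalgebra of Tᵒᵖ ⊗ T. -/
theorem exists_translation_eq [Module.FaithfullyFlat k T] (hτ : IsTranslation δ τ)
    {a : Tᵐᵒᵖ ⊗[k] T}
    (ha : extend (torsorMu δ τ).toLinearMap (unopTensor k T a) = 1 ⊗ₜ a) : ∃ h, τ h = a := by
  rw [show (torsorMu δ τ).toLinearMap = τ.toLinearMap.lTensor T ∘ₗ δ.toLinearMap from rfl,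
    ← lTensor_extend] at ha
  have h1 : (extend δ.toLinearMap ∘ₗ (unopTensor k T).toLinearMap) ∘ₗ τ.toLinearMap =
      TensorProduct.mk k T H 1 := LinearMap.ext hτ.extend_coaction
  have h2 := congrArg
    ((extend δ.toLinearMap ∘ₗ (unopTensor k T).toLinearMap).lTensor T) ha
  rw [← LinearMap.comp_apply, ← LinearMap.lTensor_comp, h1, LinearMap.lTensor_tmul] at h2
  obtain ⟨h, hh⟩ := exists_eq_one_tmul _ h2
  refine ⟨h, (unopTensor k T).injective ?_⟩
  rw [← hτ.extend_translation_extend_coaction (unopTensor k T a), hh]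
  simp

theorem tensorRight_translation_injective [Module.FaithfullyFlat k T] (hτ : IsTranslation δ τ)
    {Z : Type*} [AddCommGroup Z] [Module k Z] : Function.Injective
      (tensorRight ((unopTensor k T).toLinearMap ∘ₗ τ.toLinearMap) Z) := fun a b hab => by
  apply one_tmul_injective (k := k) (T := T)
  have := congrArg (extend (tensorRight δ.toLinearMap Z)) hab
  rwa [extend_tensorRight, extend_tensorRight, show extend δ.toLinearMap ∘ₗ _ =
    TensorProduct.mk k T H 1 from LinearMap.ext hτ.extend_coaction, tensorRight_mk_one,
    tensorRight_mk_one] at this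

theorem map_coaction_eq (hτ' : IsTranslation δ' τ') {f : T →ₐ[k] T'}
    (hf : IsTorsorHom (torsorMu δ τ) (torsorMu δ' τ') f) {g : H →ₗ[k] H'}
    (hg : ∀ h, τ' (g h) = opMap f (τ h)) (x : T) :
    TensorProduct.map f.toLinearMap g (δ x) = δ' (f x) := by
  apply hτ'.lTensor_translation_injective
  have hx : tripleMap f (torsorMu δ τ x) = torsorMu δ' τ' (f x) := AlgHom.congr_fun hf x
  refine Eq.trans ?_ hx
  rw [torsorMu_apply]
  generalize δ x = z
  induction z with
  | zero => simp
  | add a b ha hb => simp only [map_add, ha, hb]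
  | tmul t h => simp [tripleMap_tmul, hg]

/-- A torsor morphism carries the equation defining H in Tᵒᵖ ⊗ T to the one defining H', so f ⊗ f
restricts to an algebra map g. Compatibility with ε and Δ is checked after embedding in T' and in T'
⊗ T' ⊗ H'. -/
theorem exists_bialgHom [Module.FaithfullyFlat k T'] (hτ : IsTranslation δ τ)
    (hτ' : IsTranslation δ' τ') {f : T →ₐ[k] T'}
    (hf : IsTorsorHom (torsorMu δ τ) (torsorMu δ' τ') f) :
    ∃ g : H →ₐc[k] H', ∀ h, τ' (g h) = opMap f (τ h) := by
  have h1 (w : Tᵐᵒᵖ ⊗[k] T) :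
      extend (torsorMu δ' τ').toLinearMap (unopTensor k T' (opMap f w)) =
        tripleMap f (extend (torsorMu δ τ).toLinearMap (unopTensor k T w)) := by
    induction w with
    | zero => simp
    | add a b ha hb => simp only [map_add, ha, hb]
    | tmul a b =>
      have hb : tripleMap f (torsorMu δ τ b) = torsorMu δ' τ' (f b) := AlgHom.congr_fun hf b
      simp only [opMap_tmul, unopTensor_tmul, extend_tmul, AlgHom.toLinearMap_apply,
        smul_eq_tmul_one_mul, map_mul, hb, tripleMap_tmul, map_one, MulOpposite.unop_op]
  obtain ⟨g, hg⟩ := exists_algHom_comp_eq τ' hτ'.translation_injective ((opMap f).comp τ)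
    fun h => hτ'.exists_translation_eq (by
      rw [AlgHom.comp_apply, h1, hτ.extend_torsorMu_translation, tripleMap_tmul, map_one])
  have hm (w : Tᵐᵒᵖ ⊗[k] T) : mulLeft k T' (opMap f w) = f (mulLeft k T w) := by
    induction w with
    | zero => simp
    | add a b ha hb => simp only [map_add, ha, hb]
    | tmul a b => simp
  have hδ (x : T) : δ' (f x) = Algebra.TensorProduct.map f g (δ x) :=
    (hτ'.map_coaction_eq hf (g := g.toLinearMap) hg x).symm
  refine ⟨BialgHom.ofAlgHom g (AlgHom.ext fun h => ?_) (AlgHom.ext fun h => ?_), hg⟩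
  · apply algebraMap_injective_of_faithfullyFlat (k := k) (T := T')
    have := hτ'.mulLeft_translation (g h)
    rw [hg, AlgHom.comp_apply, hm, hτ.mulLeft_translation, AlgHom.commutes] at this
    exact this.symm
  · apply hτ'.tensorRight_translation_injective
    refine Eq.trans ?_ (hτ'.lTensor_coaction_translation (g h))
    rw [hg, AlgHom.comp_apply, AlgHom.comp_apply]
    let F : T ⊗[k] (T ⊗[k] H) →ₗ[k] T' ⊗[k] (T' ⊗[k] H') :=
      TensorProduct.map f.toLinearMap (TensorProduct.map f.toLinearMap g.toLinearMap)
    have h2 (w : Tᵐᵒᵖ ⊗[k] T) : δ'.toLinearMap.lTensor T' (unopTensor k T' (opMap f w)) =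
        F (δ.toLinearMap.lTensor T (unopTensor k T w)) := by
      induction w with
      | zero => simp
      | add a b ha hb => simp only [map_add, ha, hb]
      | tmul a b =>
        simp only [opMap_tmul, unopTensor_tmul, LinearMap.lTensor_tmul, AlgHom.toLinearMap_apply,
          hδ, F, TensorProduct.map_tmul]
        rfl
    rw [h2, hτ.lTensor_coaction_translation, Bialgebra.comulAlgHom_apply]
    generalize comul (R := k) h = z
    induction z with
    | zero => simp
    | add a b ha hb => simp only [map_add, ha, hb]
    | tmul a b =>
      simp only [Algebra.TensorProduct.map_tmul, tensorRight_tmul, LinearMap.comp_apply,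
        AlgHom.toLinearMap_apply, hg, LinearEquiv.coe_coe, AlgHom.comp_apply]
      generalize τ a = w
      induction w with
      | zero => simp
      | add a b ha hb => simp only [TensorProduct.add_tmul, map_add, ha, hb]
      | tmul a b => simp [F]

end IsTranslation

end Hom

/-! ### Uniqueness and the axioms of the Grunspan map -/

section Grunspan

variable {k : Type*} [CommRing k] {T : Type*} [Ring T] [Algebra k T]

/-- The right side of `compat` does not involve θ. Multiplying the five factors on the left gives
θ(x⁽¹⁾)x⁽²⁾x⁽³⁾ = θ(x). -/
theorem IsGrunspanMap.eq {μ : T →ₐ[k] T ⊗[k] (Tᵐᵒᵖ ⊗[k] T)} (hμ : IsTorsor μ)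
    {θ θ' : T →ₐ[k] T} (h : IsGrunspanMap μ θ) (h' : IsGrunspanMap μ θ') : θ = θ' := by
  have key (θ : T →ₐ[k] T) (z : T ⊗[k] (Tᵐᵒᵖ ⊗[k] T)) :
      (LinearMap.mul' k T ∘ₗ TensorProduct.map (mulRight k T)
          (LinearMap.mul' k T ∘ₗ (mulLeft k T).lTensor T) ∘ₗ
        (TensorProduct.assoc k T Tᵐᵒᵖ (T ⊗[k] (Tᵐᵒᵖ ⊗[k] T))).symm.toLinearMap)
      (((θ.toLinearMap.rTensor (Tᵐᵒᵖ ⊗[k] T)).lTensor Tᵐᵒᵖ).lTensor T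
        (flattenLeft k T (μ.toLinearMap.rTensor (Tᵐᵒᵖ ⊗[k] T) z))) =
      LinearMap.mul' k T (θ.toLinearMap.rTensor T ((mulLeft k T).lTensor T z)) := by
    induction z with
    | zero => simp
    | add a b ha hb => simp only [map_add, ha, hb]
    | tmul x a =>
      have hx := congrArg (fun z => LinearMap.mul' k T (θ.toLinearMap.lTensor T z) * mulLeft k T a)
        (hμ.mul_right x)
      simp only [LinearMap.lTensor_tmul, LinearMap.mul'_apply, one_mul] at hx
      refine Eq.trans ?_ (hx.trans (by simp))
      rw [LinearMap.rTensor_tmul, AlgHom.toLinearMap_apply]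
      generalize μ x = v
      induction v with
      | zero => simp
      | add a b ha hb => simp only [TensorProduct.add_tmul, map_add, add_mul, ha, hb]
      | tmul c d =>
        induction d with
        | zero => simp
        | add a b ha hb =>
          simp only [TensorProduct.tmul_add, TensorProduct.add_tmul, map_add, add_mul, ha, hb]
        | tmul d e => simp [flattenLeft, mul_assoc]
  ext x
  have e := (LinearMap.congr_fun h.compat x).trans (LinearMap.congr_fun h'.compat x).symm
  simp only [LinearMap.comp_apply, AlgHom.toLinearMap_apply] at e
  have e' := (key θ (μ x)).symm.trans ((congrArg _ e).trans (key θ' (μ x)))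
  rw [hμ.mul_left] at e'
  simpa using e'

variable {H : Type*} [Ring H] [HopfAlgebra k H]
  {δ : T →ₐ[k] T ⊗[k] H} {τ : H →ₐ[k] Tᵐᵒᵖ ⊗[k] T}

/-- After x₍₀₎ is split off, both sides of `compat` become S(h₍₁₎)⁽²⁾ ⊗ S(h₍₁₎)⁽¹⁾ ⊗ τ(h₍₂₎) with h
= x₍₁₎: the left by `lTensor_theta_translation`, the right by `coactTranslation_eq`. -/
theorem IsTranslation.isGrunspanMap [Module.FaithfullyFlat k T] (hτ : IsTranslation δ τ)
    {θ : T →ₐ[k] T} (hθ : ∀ x, grunspanAux δ τ x = 1 ⊗ₜ MulOpposite.op (θ x)) :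
    IsGrunspanMap (torsorMu δ τ) θ where
  isTorsorHom := hτ.isTorsorHom_of_linearMap hτ fun x => (hτ.coaction_theta hθ x).symm
  compat := by
    ext x
    simp only [LinearMap.comp_apply, AlgHom.toLinearMap_apply]
    rw [hτ.flattenLeft_torsorMu, torsorMu_apply, flattenMiddle]
    simp only [← LinearMap.comp_apply, ← LinearMap.lTensor_comp]
    congr 2
    refine LinearMap.ext fun h => ?_
    set X : (Tᵐᵒᵖ ⊗[k] (T ⊗[k] Tᵐᵒᵖ)) ⊗[k] T →ₗ[k] Tᵐᵒᵖ ⊗[k] (T ⊗[k] (Tᵐᵒᵖ ⊗[k] T)) :=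
      (TensorProduct.assoc k T Tᵐᵒᵖ T).toLinearMap.lTensor Tᵐᵒᵖ ∘ₗ
        (TensorProduct.assoc k Tᵐᵒᵖ (T ⊗[k] Tᵐᵒᵖ) T).toLinearMap with hX
    let N : (T ⊗[k] H) ⊗[k] T →ₗ[k] Tᵐᵒᵖ ⊗[k] (T ⊗[k] (Tᵐᵒᵖ ⊗[k] T)) :=
      X ∘ₗ (reverse k T ∘ₗ τ.toLinearMap.lTensor T).rTensor T
    have h1 (w : Tᵐᵒᵖ ⊗[k] T) : X ((muOp (torsorMu δ τ)).rTensor T w) =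
        N (δ.toLinearMap.rTensor T (unopTensor k T w)) := by
      induction w with
      | zero => simp
      | add a b ha hb => simp only [map_add, ha, hb]
      | tmul a b => simp [N, muOp, torsorMu_apply]
    let F : T ⊗[k] Tᵐᵒᵖ →ₗ[k] Tᵐᵒᵖ ⊗[k] T :=
      TensorProduct.map (MulOpposite.opLinearEquiv k (M := T)).toLinearMap
        (MulOpposite.opLinearEquiv k (M := T)).symm.toLinearMap
    have h2 (g : H) (w : Tᵐᵒᵖ ⊗[k] T) : N (((1 : T) ⊗ₜ[k] g) •
        (inclLeft k T H).toLinearMap.rTensor T (unopTensor k T w)) =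
          TensorProduct.assoc k Tᵐᵒᵖ T (Tᵐᵒᵖ ⊗[k] T)
            (F (TensorProduct.comm k Tᵐᵒᵖ T (τ g)) ⊗ₜ w) := by
      induction w with
      | zero => simp
      | add a b ha hb => simp only [map_add, TensorProduct.tmul_add, smul_add, ha, hb]
      | tmul a b =>
        simp only [unopTensor_tmul, LinearMap.rTensor_tmul, AlgHom.toLinearMap_apply,
          inclLeft_apply, TensorProduct.smul_tmul', smul_eq_mul,
          Algebra.TensorProduct.tmul_mul_tmul, one_mul, mul_one, N, LinearMap.comp_apply,
          LinearMap.lTensor_tmul]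
        generalize τ g = v
        induction v with
        | zero => simp
        | add a b ha hb => simp only [TensorProduct.add_tmul, TensorProduct.tmul_add, map_add, ha, hb]
        | tmul c d => simp [X, F, reverse]
    have h3 (w : Tᵐᵒᵖ ⊗[k] T) : F (((MulOpposite.opLinearEquiv k (M := T)).toLinearMap ∘ₗ
        θ.toLinearMap).lTensor T (unopTensor k T w)) = θ.toLinearMap.lTensor Tᵐᵒᵖ w := by
      induction w with
      | zero => simp
      | add a b ha hb => simp only [map_add, ha, hb]
      | tmul a b => simp [F]
    have h4 (g : H) : F (TensorProduct.comm k Tᵐᵒᵖ T (τ (antipode k g))) =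
        θ.toLinearMap.lTensor Tᵐᵒᵖ (τ g) := by
      rw [← h3, hτ.lTensor_theta_translation hθ]
      rfl
    have h5 (z : (Tᵐᵒᵖ ⊗[k] T)) (w : Tᵐᵒᵖ ⊗[k] T) :
        (θ.toLinearMap.rTensor (Tᵐᵒᵖ ⊗[k] T)).lTensor Tᵐᵒᵖ
          (TensorProduct.assoc k Tᵐᵒᵖ T (Tᵐᵒᵖ ⊗[k] T) (z ⊗ₜ w)) =
            TensorProduct.assoc k Tᵐᵒᵖ T (Tᵐᵒᵖ ⊗[k] T)
              (θ.toLinearMap.lTensor Tᵐᵒᵖ z ⊗ₜ w) := by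
      induction z with
      | zero => simp
      | add a b ha hb => simp only [TensorProduct.add_tmul, map_add, ha, hb]
      | tmul a b => simp
    have h6 := LinearMap.congr_fun hτ.coactTranslation_eq h
    rw [coactTranslation, LinearMap.comp_apply, LinearMap.comp_apply, convAct_apply] at h6
    simp only [LinearMap.comp_apply]
    rw [h1]
    refine Eq.trans ?_ (congrArg N h6).symm
    generalize comul (R := k) h = z
    induction z with
    | zero => simp
    | add a b ha hb => simp only [map_add, ha, hb]
    | tmul a b =>
      simp only [doubleTranslation, TensorProduct.map_tmul, LinearMap.comp_apply,
        TensorProduct.lift.tmul, LinearMap.compl₂_apply, LinearEquiv.coe_coe,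
        AlgHom.toLinearMap_apply, h2, mulAction_apply, h4, h5]

end Grunspan

/-! ### Hopf–Galois objects have translation maps -/

section HopfGalois

variable {k : Type*} [CommRing k] {T : Type*} [Ring T] [Algebra k T]
  {H : Type*} [Ring H] [HopfAlgebra k H] {δ : T →ₐ[k] T ⊗[k] H}

theorem galoisMap_eq_extend (δ : T →ₐ[k] T ⊗[k] H) : galoisMap δ = extend δ.toLinearMap := by
  ext x y
  simp [galoisMap, smul_eq_tmul_one_mul]

theorem IsTranslation.torsorMu_eq_inducedMu {τ : H →ₐ[k] Tᵐᵒᵖ ⊗[k] T} (hτ : IsTranslation δ τ)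
    (hδ : IsHopfGaloisObject δ) : (torsorMu δ τ).toLinearMap = inducedMu δ hδ.bijective := by
  have h1 : translationMap δ hδ.bijective =
      (unopTensor k T).toLinearMap ∘ₗ τ.toLinearMap := by
    refine LinearMap.ext fun h => hδ.bijective.1 ?_
    refine ((LinearEquiv.ofBijective (galoisMap δ) hδ.bijective).apply_symm_apply _).trans ?_
    rw [galoisMap_eq_extend]
    exact (hτ.extend_coaction h).symm
  rw [inducedMu, h1]
  have : (MulOpposite.opLinearEquiv k (M := T)).toLinearMap.rTensor T ∘ₗ
      (unopTensor k T).toLinearMap ∘ₗ τ.toLinearMap = τ.toLinearMap :=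
    LinearMap.ext fun h => (unopTensor k T).symm_apply_apply (τ h)
  rw [this]
  rfl

theorem IsHopfGaloisObject.exists_isTranslation (hδ : IsHopfGaloisObject δ) :
    ∃ τ : H →ₐ[k] Tᵐᵒᵖ ⊗[k] T, IsTranslation δ τ ∧
      (torsorMu δ τ).toLinearMap = inducedMu δ hδ.bijective := by
  have h₁ (h : H) : extend δ.toLinearMap (translationMap δ hδ.bijective h) = 1 ⊗ₜ h := by
    rw [← galoisMap_eq_extend]
    exact (LinearEquiv.ofBijective (galoisMap δ) hδ.bijective).apply_symm_apply _
  have h₂ (x : T) : extend (translationMap δ hδ.bijective) (δ x) = 1 ⊗ₜ x := by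
    apply hδ.bijective.1
    rw [galoisMap_eq_extend, extend_extend, show extend δ.toLinearMap ∘ₗ _ =
      TensorProduct.mk k T H 1 from LinearMap.ext h₁, extend_mk_one]
    simp
  obtain ⟨τ, hτ⟩ := exists_algHom_translation _ h₁ h₂
  have hτ' : IsTranslation δ τ :=
    ⟨LinearMap.congr_fun hδ.coassoc, hδ.counit, fun h => by rw [← h₁, ← hτ]; rfl,
      fun x => by rw [hτ, h₂]⟩
  exact ⟨τ, hτ', hτ'.torsorMu_eq_inducedMu hδ⟩

theorem isCoactionHom_iff {T' : Type*} [Ring T'] [Algebra k T'] {H' : Type*} [Ring H']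
    [HopfAlgebra k H'] {δ' : T' →ₐ[k] T' ⊗[k] H'} {f : T →ₐ[k] T'} {g : H →ₐc[k] H'} :
    IsCoactionHom δ δ' f g ↔
      ∀ x, TensorProduct.map f.toLinearMap (g : H →ₐ[k] H').toLinearMap (δ x) = δ' (f x) :=
  ⟨fun h x => AlgHom.congr_fun h x, fun h => AlgHom.ext h⟩

end HopfGalois

end

/-! ### The bialgebra of a torsor -/

section Structure

variable {k : Type*} [CommRing k]

/-- T ⊗ (H ⊗ –) preserves injections and T reflects them. -/
theorem flat_of_flat_tensorProduct {T H : Type*} [AddCommGroup T] [Module k T]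
    [Module.FaithfullyFlat k T] [AddCommGroup H] [Module k H] [Module.Flat k (T ⊗[k] H)] :
    Module.Flat k H := by
  rw [Module.Flat.iff_lTensor_preserves_injective_linearMap]
  intro N N' _ _ _ _ f hf
  rw [← Module.FaithfullyFlat.lTensor_injective_iff_injective k T]
  have h := Module.Flat.lTensor_preserves_injective_linearMap (M := T ⊗[k] H) f hf
  rw [LinearMap.lTensor_tensor] at h
  intro a b hab
  apply (TensorProduct.assoc k T H N).symm.injective
  apply h
  simpa using hab

variable {T : Type*} [Ring T] [Algebra k T]

variable {μ : T →ₐ[k] T ⊗[k] (Tᵐᵒᵖ ⊗[k] T)}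

/-- The map `x ⊗ y ↦ x y⁽¹⁾ ⊗ y⁽²⁾ ⊗ y⁽³⁾`. -/
def descentMap (μ : T →ₐ[k] T ⊗[k] (Tᵐᵒᵖ ⊗[k] T)) :
    Tᵐᵒᵖ ⊗[k] T →ₗ[k] T ⊗[k] (Tᵐᵒᵖ ⊗[k] T) :=
  extend μ.toLinearMap ∘ₗ (unopTensor k T).toLinearMap

theorem descentMap_tmul (x : Tᵐᵒᵖ) (y : T) : descentMap μ (x ⊗ₜ y) = x.unop • μ y := by
  simp [descentMap]

/-- The algebra of elements `x ⊗ y` such that `x y⁽¹⁾ ⊗ y⁽²⁾ ⊗ y⁽³⁾ = 1 ⊗ x ⊗ y`. -/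
def torsorAlgebra (μ : T →ₐ[k] T ⊗[k] (Tᵐᵒᵖ ⊗[k] T)) : Subalgebra k (Tᵐᵒᵖ ⊗[k] T) where
  carrier := {a | descentMap μ a = 1 ⊗ₜ a}
  mul_mem' {a b} ha hb := by
    simp only [Set.mem_ofPred_eq, descentMap, LinearMap.comp_apply, LinearEquiv.coe_coe] at ha hb ⊢
    rw [extend_unopTensor_mul μ ha, hb]
    simp
  add_mem' {a b} ha hb := by
    simp only [Set.mem_ofPred_eq] at ha hb ⊢
    rw [map_add, ha, hb, TensorProduct.tmul_add]
  algebraMap_mem' c := by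
    simp only [Set.mem_ofPred_eq, descentMap, LinearMap.comp_apply, LinearEquiv.coe_coe,
      Algebra.algebraMap_eq_smul_one, map_smul, extend_unopTensor_one, TensorProduct.tmul_smul]
    rfl

variable {H : Type*} [Ring H] [Algebra k H]

/-- The injective algebra map `ι : H → Tᵒᵖ ⊗ T` identifies `H` with the subalgebra
`torsorAlgebra μ`. -/
structure IsTorsorAlgebra (μ : T →ₐ[k] T ⊗[k] (Tᵐᵒᵖ ⊗[k] T)) (ι : H →ₐ[k] Tᵐᵒᵖ ⊗[k] T) :
    Prop where
  injective : Function.Injective ι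
  descentMap_eq (h : H) : descentMap μ (ι h) = 1 ⊗ₜ ι h
  exists_eq (a : Tᵐᵒᵖ ⊗[k] T) : descentMap μ a = 1 ⊗ₜ a → ∃ h, ι h = a

/-- The coaction `y ↦ y₍₀₎ ⊗ y₍₁₎` extended to `x ⊗ y ↦ x ⊗ y₍₀₎ ⊗ y₍₁₎`. -/
def opCoaction (δ : T →ₐ[k] T ⊗[k] H) : Tᵐᵒᵖ ⊗[k] T →ₐ[k] (Tᵐᵒᵖ ⊗[k] T) ⊗[k] H :=
  (Algebra.TensorProduct.assoc k k k Tᵐᵒᵖ T H).symm.toAlgHom.comp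
    (Algebra.TensorProduct.map (AlgHom.id k Tᵐᵒᵖ) δ)

theorem opCoaction_tmul (δ : T →ₐ[k] T ⊗[k] H) (x : Tᵐᵒᵖ) (y : T) :
    opCoaction δ (x ⊗ₜ y) = (TensorProduct.assoc k Tᵐᵒᵖ T H).symm (x ⊗ₜ δ y) := rfl

namespace IsTorsorAlgebra

variable {ι : H →ₐ[k] Tᵐᵒᵖ ⊗[k] T}

theorem exact (hι : IsTorsorAlgebra μ ι) : Function.Exact ι.toLinearMap
    (descentMap μ - TensorProduct.mk k T (Tᵐᵒᵖ ⊗[k] T) 1) := fun a => by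
  rw [LinearMap.sub_apply, sub_eq_zero]
  refine ⟨hι.exists_eq a, ?_⟩
  rintro ⟨h, rfl⟩
  exact hι.descentMap_eq h

theorem exists_lTensor_eq (hι : IsTorsorAlgebra μ ι) {M : Type*} [AddCommGroup M] [Module k M]
    [Module.Flat k M] (z : M ⊗[k] (Tᵐᵒᵖ ⊗[k] T))
    (hz : (descentMap μ).lTensor M z = (TensorProduct.mk k T (Tᵐᵒᵖ ⊗[k] T) 1).lTensor M z) :
    ∃ w : M ⊗[k] H, ι.toLinearMap.lTensor M w = z :=
  (Module.Flat.lTensor_exact M hι.exact z).1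
    (by rw [LinearMap.lTensor_sub, LinearMap.sub_apply, hz, sub_self])

theorem exists_rTensor_eq (hι : IsTorsorAlgebra μ ι) {M : Type*} [AddCommGroup M] [Module k M]
    [Module.Flat k M] (z : (Tᵐᵒᵖ ⊗[k] T) ⊗[k] M)
    (hz : (descentMap μ).rTensor M z = (TensorProduct.mk k T (Tᵐᵒᵖ ⊗[k] T) 1).rTensor M z) :
    ∃ w : H ⊗[k] M, ι.toLinearMap.rTensor M w = z :=
  (Module.Flat.rTensor_exact M hι.exact z).1
    (by rw [LinearMap.rTensor_sub]; exact sub_eq_zero.2 hz)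

theorem lTensor_injective (hι : IsTorsorAlgebra μ ι) {M : Type*} [AddCommGroup M] [Module k M]
    [Module.Flat k M] : Function.Injective (ι.toLinearMap.lTensor M) :=
  Module.Flat.lTensor_preserves_injective_linearMap _ hι.injective

theorem rTensor_injective (hι : IsTorsorAlgebra μ ι) {M : Type*} [AddCommGroup M] [Module k M]
    [Module.Flat k M] : Function.Injective (ι.toLinearMap.rTensor M) :=
  Module.Flat.rTensor_preserves_injective_linearMap _ hι.injective

/-- By coassociativity x⁽¹⁾ ⊗ x⁽²⁾μ(x⁽³⁾) comes from μ(x⁽¹⁾) ⊗ x⁽²⁾ ⊗ x⁽³⁾ by a multiplication,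
which gives x⁽¹⁾ ⊗ 1 ⊗ x⁽²⁾ ⊗ x⁽³⁾. This is the equation for T ⊗ H, by flatness of T. -/
theorem exists_coaction [Module.Flat k T] (hι : IsTorsorAlgebra μ ι) (hμ : IsTorsor μ) :
    ∃ δ : T →ₐ[k] T ⊗[k] H, ∀ x, ι.toLinearMap.lTensor T (δ x) = μ x := by
  refine exists_algHom_comp_eq (Algebra.TensorProduct.map (AlgHom.id k T) ι) hι.lTensor_injective
    μ fun x => hι.exists_lTensor_eq (μ x) ?_
  let q : Tᵐᵒᵖ ⊗[k] (T ⊗[k] (Tᵐᵒᵖ ⊗[k] T)) →ₗ[k] T ⊗[k] (Tᵐᵒᵖ ⊗[k] T) :=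
    (mulLeft k T).rTensor (Tᵐᵒᵖ ⊗[k] T) ∘ₗ
      (TensorProduct.assoc k Tᵐᵒᵖ T (Tᵐᵒᵖ ⊗[k] T)).symm.toLinearMap
  have h1 : q ∘ₗ μ.toLinearMap.lTensor Tᵐᵒᵖ = descentMap μ := by
    have (a : Tᵐᵒᵖ) (v : T ⊗[k] (Tᵐᵒᵖ ⊗[k] T)) : q (a ⊗ₜ v) = a.unop • v := by
      induction v with
      | zero => simp
      | add a b ha hb => simp only [TensorProduct.tmul_add, map_add, smul_add, ha, hb]
      | tmul a b => simp [q, TensorProduct.smul_tmul']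
    refine TensorProduct.ext' fun a b => ?_
    rw [LinearMap.comp_apply, LinearMap.lTensor_tmul, this, descentMap_tmul]
    rfl
  have h2 (z : T ⊗[k] (Tᵐᵒᵖ ⊗[k] T)) : q.lTensor T (flattenLeft k T
      (μ.toLinearMap.rTensor (Tᵐᵒᵖ ⊗[k] T) z)) =
        (TensorProduct.mk k T (Tᵐᵒᵖ ⊗[k] T) 1).lTensor T z := by
    induction z with
    | zero => simp
    | add a b ha hb => simp only [map_add, ha, hb]
    | tmul t a =>
      have h3 (v : T ⊗[k] (Tᵐᵒᵖ ⊗[k] T)) : q.lTensor T (flattenLeft k T (v ⊗ₜ a)) =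
          TensorProduct.assoc k T T (Tᵐᵒᵖ ⊗[k] T) ((mulLeft k T).lTensor T v ⊗ₜ a) := by
        induction v with
        | zero => simp
        | add a b ha hb => simp only [TensorProduct.add_tmul, map_add, ha, hb]
        | tmul b c =>
          induction c with
          | zero => simp
          | add a b ha hb =>
            simp only [TensorProduct.tmul_add, TensorProduct.add_tmul, map_add, ha, hb]
          | tmul c d => simp [q, flattenLeft]
      rw [LinearMap.rTensor_tmul, h3, AlgHom.toLinearMap_apply, hμ.mul_left]
      simp
  rw [← h1, LinearMap.lTensor_comp, ← h2]
  exact congrArg (q.lTensor T) (LinearMap.congr_fun hμ.coassoc x).symm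

section Coaction

variable {δ : T →ₐ[k] T ⊗[k] H} (hι : IsTorsorAlgebra μ ι) (hμ : IsTorsor μ)
  (hδ : ∀ x, ι.toLinearMap.lTensor T (δ x) = μ x)

include hδ in
theorem lTensor_comp_coaction : ι.toLinearMap.lTensor T ∘ₗ δ.toLinearMap = μ.toLinearMap :=
  LinearMap.ext hδ

include hι hδ in
theorem extend_coaction [Module.Flat k T] (h : H) :
    extend δ.toLinearMap (unopTensor k T (ι h)) = 1 ⊗ₜ h := by
  apply hι.lTensor_injective
  rw [lTensor_extend, lTensor_comp_coaction hδ, LinearMap.lTensor_tmul]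
  exact hι.descentMap_eq h

include hμ hδ in
theorem extend_translation (x : T) :
    extend ((unopTensor k T).toLinearMap ∘ₗ ι.toLinearMap) (δ x) = 1 ⊗ₜ x := by
  rw [← extend_lTensor, hδ, ← mulRight_rTensor_assoc_symm, hμ.mul_right]

include hι hμ hδ in
theorem bijective [Module.Flat k T] : Function.Bijective (extend δ.toLinearMap) := by
  refine Function.bijective_iff_has_inverse.2
    ⟨extend ((unopTensor k T).toLinearMap ∘ₗ ι.toLinearMap), fun z => ?_, fun z => ?_⟩
  · rw [extend_extend, show _ ∘ₗ δ.toLinearMap = TensorProduct.mk k T T 1 from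
      LinearMap.ext (extend_translation hμ hδ), extend_mk_one]
  · rw [extend_extend, show extend δ.toLinearMap ∘ₗ _ = TensorProduct.mk k T H 1 from
      LinearMap.ext (hι.extend_coaction hδ), extend_mk_one]

include hι hμ hδ in
theorem flat [Module.FaithfullyFlat k T] : Module.Flat k H := by
  have : Module.Flat k (T ⊗[k] H) :=
    Module.Flat.of_linearEquiv (LinearEquiv.ofBijective _ (hι.bijective hμ hδ)).symm
  exact flat_of_flat_tensorProduct (T := T)

include hμ hδ in
-- If δ(x) = x ⊗ 1, then x₍₀₎τ(x₍₁₎) = 1 ⊗ x reads x ⊗ 1 = 1 ⊗ x, and descent puts x in k.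
theorem coinvariants [Module.FaithfullyFlat k T] (x : T) :
    δ x = x ⊗ₜ[k] (1 : H) ↔ x ∈ Set.range (algebraMap k T) := by
  constructor
  · intro hx
    have h1 := extend_translation hμ hδ x
    rw [hx, extend_tmul, LinearMap.comp_apply, AlgHom.toLinearMap_apply, map_one] at h1
    have h2 : x ⊗ₜ[k] (1 : T) = 1 ⊗ₜ x := by
      rw [← h1]
      simp [Algebra.TensorProduct.one_def, TensorProduct.smul_tmul']
    obtain ⟨c, hc⟩ := exists_eq_one_tmul (x ⊗ₜ[k] (1 : k)) (by
      have := congrArg ((TensorProduct.rid k T).symm.toLinearMap.lTensor T) h2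
      simpa using this)
    refine ⟨c, ?_⟩
    simpa [Algebra.algebraMap_eq_smul_one] using (congrArg (TensorProduct.rid k T) hc).symm
  · rintro ⟨c, rfl⟩
    simp [Algebra.TensorProduct.algebraMap_apply]

include hι hμ hδ in
-- This is torsor coassociativity with its last two factors Tᵒᵖ ⊗ T cut down to H through ι.
theorem rTensor_coaction [Module.FaithfullyFlat k T] (x : T) : μ.toLinearMap.rTensor H (δ x) =
    (TensorProduct.assoc k T (Tᵐᵒᵖ ⊗[k] T) H).symm
      ((opCoaction δ).toLinearMap.lTensor T (μ x)) := by
  have : Module.Flat k Tᵐᵒᵖ :=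
    Module.Flat.of_linearEquiv (MulOpposite.opLinearEquiv k (M := T)).symm
  apply hι.lTensor_injective
  have hfl : Function.Injective (flattenLeft k T) := by
    rw [flattenLeft, LinearMap.coe_comp]
    exact Function.Injective.comp
      ((TensorProduct.assoc k Tᵐᵒᵖ T (Tᵐᵒᵖ ⊗[k] T)).lTensor T).injective
      (TensorProduct.assoc k T (Tᵐᵒᵖ ⊗[k] T) (Tᵐᵒᵖ ⊗[k] T)).injective
  apply hfl
  have h1 (z : T ⊗[k] (Tᵐᵒᵖ ⊗[k] T)) : flattenLeft k T
      (ι.toLinearMap.lTensor (T ⊗[k] (Tᵐᵒᵖ ⊗[k] T))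
        ((TensorProduct.assoc k T (Tᵐᵒᵖ ⊗[k] T) H).symm
          ((opCoaction δ).toLinearMap.lTensor T z))) =
      (μ.toLinearMap.lTensor Tᵐᵒᵖ).lTensor T z := by
    induction z with
    | zero => simp
    | add a b ha hb => simp only [map_add, ha, hb]
    | tmul t a =>
      induction a with
      | zero => simp
      | add a b ha hb => simp only [TensorProduct.tmul_add, map_add, ha, hb]
      | tmul a b =>
        simp only [LinearMap.lTensor_tmul, AlgHom.toLinearMap_apply, opCoaction_tmul, ← hδ]
        generalize δ b = v
        induction v with
        | zero => simp
        | add a b ha hb => simp only [TensorProduct.tmul_add, map_add, ha, hb]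
        | tmul c d => simp [flattenLeft]
  rw [h1]
  refine Eq.trans ?_ (LinearMap.congr_fun hμ.coassoc x)
  simp only [LinearMap.comp_apply]
  rw [← LinearMap.comp_apply (f := ι.toLinearMap.lTensor _), LinearMap.lTensor_comp_rTensor,
    ← LinearMap.rTensor_comp_lTensor, LinearMap.comp_apply, hδ]
  rfl

include hι hμ hδ in
-- The map x ⊗ y ↦ x ⊗ δ(y) commutes with `descentMap`, so on H its values satisfy the defining
-- equation of H in the first factor; flatness of H puts them in H ⊗ H.
theorem exists_comul [Module.FaithfullyFlat k T] : ∃ Δ : H →ₐ[k] H ⊗[k] H,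
    ∀ h, ι.toLinearMap.rTensor H (Δ h) = opCoaction δ (ι h) := by
  have := hι.flat hμ hδ
  suffices h : ∀ h, (descentMap μ).rTensor H (opCoaction δ (ι h)) =
      (TensorProduct.mk k T (Tᵐᵒᵖ ⊗[k] T) 1).rTensor H (opCoaction δ (ι h)) from
    exists_algHom_comp_eq (Algebra.TensorProduct.map ι (AlgHom.id k H)) hι.rTensor_injective
      ((opCoaction δ).comp ι) fun x => hι.exists_rTensor_eq _ (h x)
  intro h
  let U : T ⊗[k] (Tᵐᵒᵖ ⊗[k] T) →ₗ[k] (T ⊗[k] (Tᵐᵒᵖ ⊗[k] T)) ⊗[k] H :=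
    (TensorProduct.assoc k T (Tᵐᵒᵖ ⊗[k] T) H).symm.toLinearMap ∘ₗ
      (opCoaction δ).toLinearMap.lTensor T
  have hU (t : T) (z : T ⊗[k] (Tᵐᵒᵖ ⊗[k] T)) : U (t • z) = t • U z := by
    induction z with
    | zero => simp
    | add a b ha hb => simp only [smul_add, map_add, ha, hb]
    | tmul a b =>
      simp only [U, TensorProduct.smul_tmul', LinearMap.comp_apply, LinearMap.lTensor_tmul]
      generalize (opCoaction δ).toLinearMap b = v
      induction v with
      | zero => simp
      | add a b ha hb => simp only [TensorProduct.tmul_add, smul_add, map_add, ha, hb]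
      | tmul c d => simp [TensorProduct.smul_tmul']
  have h1 (w : Tᵐᵒᵖ ⊗[k] T) : (descentMap μ).rTensor H (opCoaction δ w) =
      U (descentMap μ w) := by
    induction w with
    | zero => simp
    | add a b ha hb => simp only [map_add, ha, hb]
    | tmul a b =>
      rw [descentMap_tmul, hU, show U (μ b) = μ.toLinearMap.rTensor H (δ b) from
        (hι.rTensor_coaction hμ hδ b).symm, opCoaction_tmul]
      generalize δ b = v
      induction v with
      | zero => simp
      | add a b ha hb => simp only [TensorProduct.tmul_add, smul_add, map_add, ha, hb]
      | tmul c d => simp [TensorProduct.smul_tmul', descentMap_tmul]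
  rw [h1, hι.descentMap_eq]
  simp only [U, LinearMap.comp_apply, LinearMap.lTensor_tmul, AlgHom.toLinearMap_apply]
  generalize opCoaction δ (ι h) = v
  induction v with
  | zero => simp
  | add a b ha hb => simp only [TensorProduct.tmul_add, map_add, ha, hb]
  | tmul c d => simp

include hι hμ in
-- Multiplying the last two factors of the defining equation gives xy ⊗ 1 = 1 ⊗ xy, so xy descends
-- to k; being central, it makes ε multiplicative.
theorem exists_counit [Module.FaithfullyFlat k T] : ∃ ε : H →ₐ[k] k,
    ∀ h, algebraMap k T (ε h) = mulLeft k T (ι h) := by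
  have hinj := algebraMap_injective_of_faithfullyFlat (k := k) (T := T)
  have hm (a b : Tᵐᵒᵖ ⊗[k] T) (c : k) (ha : mulLeft k T a = algebraMap k T c) :
      mulLeft k T (a * b) = algebraMap k T c * mulLeft k T b := by
    induction b with
    | zero => simp
    | add b b' hb hb' => simp only [mul_add, map_add, hb, hb']
    | tmul x y =>
      have : mulLeft k T (a * x ⊗ₜ y) = x.unop * mulLeft k T a * y := by
        clear ha
        induction a with
        | zero => simp
        | add a a' ha ha' => simp only [add_mul, mul_add, map_add, ha, ha']
        | tmul a a' => simp [mul_assoc]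
      rw [this, ha, mulLeft_tmul, ← mul_assoc, Algebra.commutes]
  have h1 (w : Tᵐᵒᵖ ⊗[k] T) : (mulLeft k T).lTensor T (descentMap μ w) =
      mulLeft k T w ⊗ₜ 1 := by
    induction w with
    | zero => simp
    | add a b ha hb => simp only [map_add, TensorProduct.add_tmul, ha, hb]
    | tmul a b =>
      rw [descentMap_tmul, lTensor_smul, hμ.mul_left]
      simp [TensorProduct.smul_tmul']
  obtain ⟨ε, hε⟩ := exists_linearMap_comp_eq (Algebra.linearMap k T) hinj
    (mulLeft k T ∘ₗ ι.toLinearMap) fun h => by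
      have h2 := h1 (ι h)
      rw [hι.descentMap_eq, LinearMap.lTensor_tmul] at h2
      obtain ⟨c, hc⟩ := exists_eq_one_tmul (mulLeft k T (ι h) ⊗ₜ[k] (1 : k)) (by
        have := congrArg ((TensorProduct.rid k T).symm.toLinearMap.lTensor T) h2.symm
        simpa using this)
      refine ⟨c, ?_⟩
      simpa [Algebra.algebraMap_eq_smul_one] using (congrArg (TensorProduct.rid k T) hc).symm
  refine ⟨AlgHom.ofLinearMap ε (hinj ?_) fun x y => hinj ?_, hε⟩
  · refine (hε 1).trans ?_
    simp [Algebra.TensorProduct.one_def]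
  · refine (hε (x * y)).trans ?_
    rw [LinearMap.comp_apply, AlgHom.toLinearMap_apply, map_mul, hm (ι x) (ι y) (ε x) (hε x).symm, map_mul]
    exact congrArg _ (hε y).symm

variable {Δ : H →ₐ[k] H ⊗[k] H} (hΔ : ∀ h, ι.toLinearMap.rTensor H (Δ h) = opCoaction δ (ι h))
  {ε : H →ₐ[k] k} (hε : ∀ h, algebraMap k T (ε h) = mulLeft k T (ι h))

include hι hμ hδ hΔ in
theorem coaction_coassoc [Module.FaithfullyFlat k T] (x : T) :
    tensorRight δ.toLinearMap H (δ x) = Δ.toLinearMap.lTensor T (δ x) := by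
  have := hι.flat hμ hδ
  have hinj : Function.Injective ((ι.toLinearMap.rTensor H).lTensor T) :=
    Module.Flat.lTensor_preserves_injective_linearMap _ hι.rTensor_injective
  apply hinj
  have h1 : ι.toLinearMap.rTensor H ∘ₗ Δ.toLinearMap =
      (opCoaction δ).toLinearMap ∘ₗ ι.toLinearMap := LinearMap.ext hΔ
  rw [← LinearMap.comp_apply, ← LinearMap.comp_apply, ← LinearMap.lTensor_comp, h1,
    LinearMap.lTensor_comp, LinearMap.comp_apply, LinearMap.comp_apply, hδ]
  apply (TensorProduct.assoc k T (Tᵐᵒᵖ ⊗[k] T) H).symm.injective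
  rw [← hι.rTensor_coaction hμ hδ]
  generalize δ x = z
  induction z with
  | zero => simp
  | add a b ha hb => simp only [map_add, ha, hb]
  | tmul t h =>
    rw [LinearMap.rTensor_tmul, AlgHom.toLinearMap_apply, ← hδ, tensorRight_tmul,
      AlgHom.toLinearMap_apply]
    generalize δ t = v
    induction v with
    | zero => simp
    | add a b ha hb => simp only [TensorProduct.add_tmul, map_add, ha, hb]
    | tmul a b => simp

include hδ hμ hε in
theorem coaction_counit [Module.FaithfullyFlat k T] (x : T) :
    ε.toLinearMap.lTensor T (δ x) = x ⊗ₜ[k] (1 : k) := by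
  have hinj : Function.Injective ((Algebra.linearMap k T).lTensor T) :=
    Module.Flat.lTensor_preserves_injective_linearMap _
      (algebraMap_injective_of_faithfullyFlat (k := k) (T := T))
  apply hinj
  rw [← LinearMap.comp_apply, ← LinearMap.lTensor_comp, show Algebra.linearMap k T ∘ₗ
    ε.toLinearMap = mulLeft k T ∘ₗ ι.toLinearMap from LinearMap.ext hε, LinearMap.lTensor_comp,
    LinearMap.comp_apply, hδ, hμ.mul_left]
  simp

include hι hμ hδ hΔ in
theorem comul_coassoc [Module.FaithfullyFlat k T] (h : H) :
    TensorProduct.assoc k H H H (Δ.toLinearMap.rTensor H (Δ h)) =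
      Δ.toLinearMap.lTensor H (Δ h) := by
  have := hι.flat hμ hδ
  apply hι.rTensor_injective
  have h1 : ι.toLinearMap.rTensor H ∘ₗ Δ.toLinearMap =
      (opCoaction δ).toLinearMap ∘ₗ ι.toLinearMap := LinearMap.ext hΔ
  have h2 (z : H ⊗[k] H) : ι.toLinearMap.rTensor (H ⊗[k] H)
      (TensorProduct.assoc k H H H (Δ.toLinearMap.rTensor H z)) =
        TensorProduct.assoc k (Tᵐᵒᵖ ⊗[k] T) H H ((opCoaction δ).toLinearMap.rTensor H
          (ι.toLinearMap.rTensor H z)) := by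
    rw [← LinearMap.comp_apply, ← LinearMap.rTensor_comp, ← h1]
    induction z with
    | zero => simp
    | add a b ha hb => simp only [map_add, ha, hb]
    | tmul a b =>
      simp only [LinearMap.rTensor_tmul, LinearMap.comp_apply]
      generalize Δ.toLinearMap a = v
      induction v with
      | zero => simp
      | add a b ha hb => simp only [TensorProduct.add_tmul, map_add, ha, hb]
      | tmul a b => simp
  rw [h2, ← LinearMap.comp_apply (f := ι.toLinearMap.rTensor _), LinearMap.rTensor_comp_lTensor,
    ← LinearMap.lTensor_comp_rTensor, LinearMap.comp_apply, hΔ]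
  generalize ι h = w
  induction w with
  | zero => simp
  | add a b ha hb => simp only [map_add, ha, hb]
  | tmul a b =>
    have h3 (z : T ⊗[k] H) : TensorProduct.assoc k (Tᵐᵒᵖ ⊗[k] T) H H
        ((opCoaction δ).toLinearMap.rTensor H ((TensorProduct.assoc k Tᵐᵒᵖ T H).symm (a ⊗ₜ z))) =
        (TensorProduct.assoc k Tᵐᵒᵖ T (H ⊗[k] H)).symm
          (a ⊗ₜ tensorRight δ.toLinearMap H z) := by
      induction z with
      | zero => simp
      | add a b ha hb => simp only [TensorProduct.tmul_add, map_add, ha, hb]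
      | tmul c d =>
        simp only [TensorProduct.assoc_symm_tmul, LinearMap.rTensor_tmul,
          AlgHom.toLinearMap_apply, opCoaction_tmul, tensorRight_tmul]
        generalize δ c = v
        induction v with
        | zero => simp
        | add a b ha hb =>
          simp only [TensorProduct.tmul_add, TensorProduct.add_tmul, map_add, ha, hb]
        | tmul a b => simp
    rw [opCoaction_tmul, h3, hι.coaction_coassoc hμ hδ hΔ]
    generalize δ b = v
    induction v with
    | zero => simp
    | add a b ha hb => simp only [TensorProduct.tmul_add, map_add, ha, hb]
    | tmul a b => simp

include hι hδ hΔ hε in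
-- Over T the left side becomes h⁽¹⁾δ(h⁽²⁾) = β(ι(h)) = 1 ⊗ h.
theorem rTensor_counit_comul [Module.FaithfullyFlat k T] (h : H) :
    ε.toLinearMap.rTensor H (Δ h) = 1 ⊗ₜ h := by
  apply (TensorProduct.lid k H).injective
  apply one_tmul_injective (k := k) (T := T)
  have h1 (z : H ⊗[k] H) : (1 : T) ⊗ₜ[k] TensorProduct.lid k H (ε.toLinearMap.rTensor H z) =
      (mulLeft k T).rTensor H (ι.toLinearMap.rTensor H z) := by
    induction z with
    | zero => simp
    | add a b ha hb => simp only [map_add, TensorProduct.tmul_add, ha, hb]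
    | tmul a b =>
      simp [← hε, Algebra.algebraMap_eq_smul_one, TensorProduct.smul_tmul]
  have h2 (w : Tᵐᵒᵖ ⊗[k] T) : (mulLeft k T).rTensor H (opCoaction δ w) =
      extend δ.toLinearMap (unopTensor k T w) := by
    induction w with
    | zero => simp
    | add a b ha hb => simp only [map_add, ha, hb]
    | tmul a b =>
      rw [opCoaction_tmul, unopTensor_tmul, extend_tmul, AlgHom.toLinearMap_apply]
      generalize δ b = v
      induction v with
      | zero => simp
      | add a b ha hb => simp only [TensorProduct.tmul_add, map_add, smul_add, ha, hb]
      | tmul c d => simp [TensorProduct.smul_tmul']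
  simp only [h1, hΔ, h2, hι.extend_coaction hδ]
  simp

include hι hμ hδ hΔ hε in
theorem lTensor_counit_comul [Module.FaithfullyFlat k T] (h : H) :
    ε.toLinearMap.lTensor H (Δ h) = h ⊗ₜ 1 := by
  apply (TensorProduct.rid k H).injective
  apply hι.injective
  have h1 (z : H ⊗[k] H) : ι (TensorProduct.rid k H (ε.toLinearMap.lTensor H z)) =
      TensorProduct.rid k _ (ε.toLinearMap.lTensor _ (ι.toLinearMap.rTensor H z)) := by
    induction z with
    | zero => simp
    | add a b ha hb => simp only [map_add, ha, hb]
    | tmul a b => simp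
  have h2 (w : Tᵐᵒᵖ ⊗[k] T) :
      TensorProduct.rid k _ (ε.toLinearMap.lTensor _ (opCoaction δ w)) = w := by
    induction w with
    | zero => simp
    | add a b ha hb => simp only [map_add, ha, hb]
    | tmul a b =>
      have h3 (z : T ⊗[k] H) : TensorProduct.rid k _ (ε.toLinearMap.lTensor _
          ((TensorProduct.assoc k Tᵐᵒᵖ T H).symm (a ⊗ₜ z))) =
            a ⊗ₜ TensorProduct.rid k T (ε.toLinearMap.lTensor T z) := by
        induction z with
        | zero => simp
        | add a b ha hb => simp only [TensorProduct.tmul_add, map_add, ha, hb]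
        | tmul c d => simp
      rw [opCoaction_tmul, h3, coaction_counit hμ hδ hε]
      simp
  rw [h1, hΔ, h2]
  simp

end Coaction

end IsTorsorAlgebra

end Structure

/-! ### The Hopf algebra of a torsor and the main theorem -/

section Main

variable {k : Type*} [CommRing k] {T : Type*} [Ring T] [Algebra k T]

theorem isTorsorAlgebra_val (μ : T →ₐ[k] T ⊗[k] (Tᵐᵒᵖ ⊗[k] T)) :
    IsTorsorAlgebra (H := torsorAlgebra μ) μ (torsorAlgebra μ).val where
  injective := Subtype.val_injective
  descentMap_eq h := h.2
  exists_eq a ha := ⟨⟨a, ha⟩, rfl⟩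

theorem IsTorsorAlgebra.exists_hopfAlgebra [Module.FaithfullyFlat k T] {H : Type w} [Ring H]
    [Algebra k H] {μ : T →ₐ[k] T ⊗[k] (Tᵐᵒᵖ ⊗[k] T)} {ι : H →ₐ[k] Tᵐᵒᵖ ⊗[k] T}
    (hι : IsTorsorAlgebra μ ι) (hμ : IsTorsor μ) :
    ∃ (H : Type w) (_ : Ring H) (_ : HopfAlgebra k H) (δ : T →ₐ[k] T ⊗[k] H)
      (τ : H →ₐ[k] Tᵐᵒᵖ ⊗[k] T), IsHopfGaloisObject δ ∧ IsTranslation δ τ ∧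
        μ = torsorMu δ τ := by
  obtain ⟨δ, hδ⟩ := hι.exists_coaction hμ
  obtain ⟨Δ, hΔ⟩ := hι.exists_comul hμ hδ
  obtain ⟨ε, hε⟩ := hι.exists_counit hμ
  let _ : Bialgebra k H := Bialgebra.ofAlgHom Δ ε
    (AlgHom.ext (hι.comul_coassoc hμ hδ hΔ)) (AlgHom.ext (hι.rTensor_counit_comul hδ hΔ hε))
    (AlgHom.ext (hι.lTensor_counit_comul hμ hδ hΔ hε))
  have hτ : IsTranslation δ ι :=
    ⟨hι.coaction_coassoc hμ hδ hΔ, coaction_counit hμ hδ hε, hι.extend_coaction hδ,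
      extend_translation hμ hδ⟩
  obtain ⟨S, hS₁, hS₂⟩ := hτ.exists_antipode
  refine ⟨H, inferInstance, HopfAlgebra.ofConvInverse S hS₁ hS₂, δ, ι, ?_, hτ, AlgHom.ext fun x => (hδ x).symm⟩
  let _ : HopfAlgebra k H := HopfAlgebra.ofConvInverse S hS₁ hS₂
  exact
    { coassoc := LinearMap.ext hτ.coassoc
      counit := hτ.counit
      flat := hι.flat hμ hδ
      faithfullyFlat := inferInstance
      bijective := by
        rw [galoisMap_eq_extend]
        exact hι.bijective hμ hδ
      coinvariants := coinvariants hμ hδ }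

end Main

end

end QuantumTorsor

theorem mainTheorem2 (k : Type u) [CommRing k] :
    -- every faithfully flat torsor has a (unique) Grunspan map
    (∀ (T : Type v) [Ring T] [Algebra k T] [Module.FaithfullyFlat k T]
      (μ : T →ₐ[k] T ⊗[k] (Tᵐᵒᵖ ⊗[k] T)), QuantumTorsor.IsTorsor μ →
        ∃! θ : T →ₐ[k] T, QuantumTorsor.IsGrunspanMap μ θ) ∧
    -- every faithfully flat Hopf-Galois object is a torsor
    (∀ (T : Type v) [Ring T] [Algebra k T] (H : Type w) [Ring H] [HopfAlgebra k H]
      (δ : T →ₐ[k] T ⊗[k] H) (hδ : QuantumTorsor.IsHopfGaloisObject δ),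
        ∃ μ : T →ₐ[k] T ⊗[k] (Tᵐᵒᵖ ⊗[k] T), QuantumTorsor.IsTorsor μ ∧
          μ.toLinearMap = QuantumTorsor.inducedMu δ hδ.bijective) ∧
    -- every faithfully flat torsor arises in this way from a Hopf-Galois object
    (∀ (T : Type v) [Ring T] [Algebra k T] [Module.FaithfullyFlat k T]
      (μ : T →ₐ[k] T ⊗[k] (Tᵐᵒᵖ ⊗[k] T)), QuantumTorsor.IsTorsor μ →
        ∃ (H : Type v) (_ : Ring H) (_ : HopfAlgebra k H) (δ : T →ₐ[k] T ⊗[k] H)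
          (hδ : QuantumTorsor.IsHopfGaloisObject δ),
            μ.toLinearMap = QuantumTorsor.inducedMu δ hδ.bijective) ∧
    -- the passage from Hopf-Galois objects to torsors is fully faithful
    (∀ (T : Type v) [Ring T] [Algebra k T] (H : Type w) [Ring H] [HopfAlgebra k H]
      (T' : Type v') [Ring T'] [Algebra k T'] (H' : Type w') [Ring H'] [HopfAlgebra k H']
      (δ : T →ₐ[k] T ⊗[k] H) (hδ : QuantumTorsor.IsHopfGaloisObject δ)
      (δ' : T' →ₐ[k] T' ⊗[k] H') (hδ' : QuantumTorsor.IsHopfGaloisObject δ')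
      (μ : T →ₐ[k] T ⊗[k] (Tᵐᵒᵖ ⊗[k] T)) (μ' : T' →ₐ[k] T' ⊗[k] (T'ᵐᵒᵖ ⊗[k] T')),
        μ.toLinearMap = QuantumTorsor.inducedMu δ hδ.bijective →
        μ'.toLinearMap = QuantumTorsor.inducedMu δ' hδ'.bijective →
        ∀ f : T →ₐ[k] T',
          (QuantumTorsor.IsTorsorHom μ μ' f →
            ∃! g : H →ₐc[k] H', QuantumTorsor.IsCoactionHom δ δ' f g) ∧
          (∀ g : H →ₐc[k] H', QuantumTorsor.IsCoactionHom δ δ' f g →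
            QuantumTorsor.IsTorsorHom μ μ' f)) := by
  refine ⟨fun T _ _ _ μ hμ => ?_, fun T _ _ H _ _ δ hδ => ?_, fun T _ _ _ μ hμ => ?_,
    fun T _ _ H _ _ T' _ _ H' _ _ δ hδ δ' hδ' μ μ' hμ hμ' f => ?_⟩
  · obtain ⟨H, _, _, δ, τ, hδ, hτ, rfl⟩ :=
      (QuantumTorsor.isTorsorAlgebra_val μ).exists_hopfAlgebra hμ
    obtain ⟨θ, hθ⟩ := hτ.exists_grunspanAux_eq hδ.coinvariants
    exact ⟨θ, hτ.isGrunspanMap hθ, fun θ' h' => h'.eq hμ (hτ.isGrunspanMap hθ)⟩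
  · obtain ⟨τ, hτ, h⟩ := hδ.exists_isTranslation
    exact ⟨_, hτ.isTorsor, h⟩
  · obtain ⟨H, _, _, δ, τ, hδ, hτ, h⟩ :=
      (QuantumTorsor.isTorsorAlgebra_val μ).exists_hopfAlgebra hμ
    exact ⟨_, _, _, δ, hδ, h ▸ hτ.torsorMu_eq_inducedMu hδ⟩
  · obtain ⟨τ, hτ, h⟩ := hδ.exists_isTranslation
    obtain ⟨τ', hτ', h'⟩ := hδ'.exists_isTranslation
    obtain rfl : μ = QuantumTorsor.torsorMu δ τ := AlgHom.toLinearMap_injective (hμ.trans h.symm)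
    obtain rfl : μ' = QuantumTorsor.torsorMu δ' τ' :=
      AlgHom.toLinearMap_injective (hμ'.trans h'.symm)
    have := hδ'.faithfullyFlat
    refine ⟨fun hf => ?_, fun g hg =>
      hτ.isTorsorHom_of_linearMap hτ' (QuantumTorsor.isCoactionHom_iff.1 hg)⟩
    obtain ⟨g, hg⟩ := hτ.exists_bialgHom hτ' hf
    refine ⟨g, QuantumTorsor.isCoactionHom_iff.2 fun x => ?_, fun g' hg' => ?_⟩
    · exact hτ'.map_coaction_eq hf (g := (g : H →ₐ[k] H').toLinearMap) hg x
    -- Any admissible g' satisfies τ'(g'(h)) = (f ⊗ f)(τ(h)), which determines it since τ' is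
    -- injective.
    · refine BialgHom.ext fun h => hτ'.translation_injective ?_
      rw [hg]
      exact (hτ.opMap_translation hτ' (QuantumTorsor.isCoactionHom_iff.1 hg') h).symm
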